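/- Let $N \ge 1$ and let $0 \le a_i < \infty$, $0 < b_i < \infty$ for $1 \le i \le N+1$. Consider $N+1$ particles on $\mathbb{Z}$ at positions $X_1(t) < X_2(t) < \cdots < X_{N+1}(t)$, evolving as a continuous-time Markov chain from a fixed initial configuration: particle $i$ attempts to jump one step to the left at rate $a_i$ and one step to the right at rate $b_i$, and an attempted jump is executed if the target site is empty and suppressed otherwise. Let $\eta_i(t) = X_{i+1}(t) - X_i(t) - 1$, $1 \le i \le N$, denote the gaps. For $1 \le k \le N+1$ put \[ \alpha_k = \frac{a_1 \cdots a_k}{b_1 \cdots b_k}, \qquad \beta_k = \sum_{j=1}^{k} \frac{a_{j+1} a_{j+2} \cdots a_k}{b_j b_{j+1} \cdots b_k} = \frac{1}{b_k} + \frac{a_k}{b_k b_{k-1}} + \cdots + \frac{a_k \cdots a_2}{b_k \cdots b_1} \] (an empty product is $1$), let \[ \hat v_{N+1} = \frac{1 - \alpha_{N+1}}{\beta_{N+1}}, \qquad \rho_i = \alpha_i + \beta_i \hat v_{N+1} \quad (1 \le i \le N), \] and suppose that $\rho_i < 1$ for all $1 \le i \le N$. Then there exists $\sigma^2 \in (0,\infty)$,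 depending only on the rates (and not on the initial configuration), such that for all $w \in \mathbb{R}$ and all integers $z_1, \ldots, z_N \ge 0$, \[ \lim_{t \to \infty} \mathbb{P}\left[ \frac{X_1(t) - \hat v_{N+1} t}{\sqrt{\sigma^2 t}} \le w,\ \eta_1(t) = z_1, \ldots, \eta_N(t) = z_N \right] = \Phi(w) \prod_{i=1}^{N} \rho_i^{z_i} (1 - \rho_i), \] where $\Phi$ is the cumulative distribution function of $\mathcal{N}(0,1)$. In particular, if $Z \sim \mathcal{N}(0,\sigma^2)$, then, as $t \to \infty$, \[ \left( \frac{X_i(t) - \hat v_{N+1} t}{\sqrt{t}} \right)_{1 \le i \le N+1} \longrightarrow (Z, \ldots, Z) \quad \text{in distribution}. \] -/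

import Mathlib

open MeasureTheory ProbabilityTheory Filter Topology
open scoped NNReal BoundedContinuousFunction

namespace Exclusion

/-- Configurations of `N + 1` particles on `ℤ`, listed in increasing order of position.
Particles are labelled by `Fin (N + 1)`, from left to right. -/
abbrev Config (N : ℕ) : Type := {x : Fin (N + 1) → ℤ // StrictMono x}

/-- The number of empty sites between the consecutive particles `i` and `i + 1`. -/
def gap {N : ℕ} (x : Config N) (i : Fin N) : ℤ :=
  x.1 i.succ - x.1 i.castSucc - 1

theorem strictMono_update_right {N : ℕ} (x : Config N) (i : Fin (N + 1))
    (h : ¬ ∃ j, x.1 j = x.1 i + 1) :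
    StrictMono (Function.update x.1 i (x.1 i + 1)) := by
  intro k l hkl
  have hx := x.2 hkl
  by_cases hk : k = i
  · subst hk
    have hl : l ≠ k := hkl.ne'
    simp only [Function.update_self, Function.update_of_ne hl]
    have : x.1 l ≠ x.1 k + 1 := fun e => h ⟨l, e⟩
    omega
  · by_cases hl : l = i
    · subst hl
      simp only [Function.update_self, Function.update_of_ne hk]
      omega
    · simpa only [Function.update_of_ne hk, Function.update_of_ne hl] using hx

theorem strictMono_update_left {N : ℕ} (x : Config N) (i : Fin (N + 1))
    (h : ¬ ∃ j, x.1 j = x.1 i - 1) :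
    StrictMono (Function.update x.1 i (x.1 i - 1)) := by
  intro k l hkl
  have hx := x.2 hkl
  by_cases hk : k = i
  · subst hk
    have hl : l ≠ k := hkl.ne'
    simp only [Function.update_self, Function.update_of_ne hl]
    omega
  · by_cases hl : l = i
    · subst hl
      simp only [Function.update_self, Function.update_of_ne hk]
      have : x.1 k ≠ x.1 l - 1 := fun e => h ⟨k, e⟩
      omega
    · simpa only [Function.update_of_ne hk, Function.update_of_ne hl] using hx

open Classical in
/-- Particle `i` attempts to jump to the right: it moves one step to the right if the target site
is empty, and the jump is suppressed otherwise. -/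
noncomputable def stepRight {N : ℕ} (i : Fin (N + 1)) (x : Config N) : Config N :=
  if h : ∃ j, x.1 j = x.1 i + 1 then x
  else ⟨Function.update x.1 i (x.1 i + 1), strictMono_update_right x i h⟩

open Classical in
/-- Particle `i` attempts to jump to the left: it moves one step to the left if the target site
is empty, and the jump is suppressed otherwise. -/
noncomputable def stepLeft {N : ℕ} (i : Fin (N + 1)) (x : Config N) : Config N :=
  if h : ∃ j, x.1 j = x.1 i - 1 then x
  else ⟨Function.update x.1 i (x.1 i - 1), strictMono_update_left x i h⟩

/-- Composition `f ↦ f ∘ φ`, as a bounded operator on the bounded functions on configurations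
(every function on the discrete space of configurations is continuous). -/
noncomputable def compOp {N : ℕ} (φ : Config N → Config N) :
    (Config N →ᵇ ℝ) →L[ℝ] (Config N →ᵇ ℝ) :=
  BoundedContinuousFunction.compContinuousCLM ℝ ℝ ⟨φ, continuous_of_discreteTopology⟩

/-- The generator of the exclusion process, in which particle `i` attempts to jump to the left at
rate `a i` and to the right at rate `b i`:
`(L f)(x) = ∑ i, a i * (f (stepLeft i x) - f x) + b i * (f (stepRight i x) - f x)`.
It is a bounded operator since the total rate is finite. -/
noncomputable def generator {N : ℕ} (a b : Fin (N + 1) → ℝ) :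
    (Config N →ᵇ ℝ) →L[ℝ] (Config N →ᵇ ℝ) :=
  ∑ i, (a i • (compOp (stepLeft i) - 1) + b i • (compOp (stepRight i) - 1))

theorem generator_apply {N : ℕ} (a b : Fin (N + 1) → ℝ) (f : Config N →ᵇ ℝ) (x : Config N) :
    generator a b f x
      = ∑ i, (a i * (f (stepLeft i x) - f x) + b i * (f (stepRight i x) - f x)) := by
  simp [generator, compOp, BoundedContinuousFunction.coe_sum]

/-- The operator semigroup `exp (t A) = ∑ n, t ^ n / n! • A ^ n` generated by a bounded operator `A`
on a (Banach) space. -/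
noncomputable def opSemigroup {E : Type*} [NormedAddCommGroup E] [NormedSpace ℝ E]
    (A : E →L[ℝ] E) (t : ℝ≥0) : E →L[ℝ] E :=
  NormedSpace.exp ((t : ℝ) • A)

/-- The transition semigroup `exp (t L)` of the exclusion process, with `L = generator a b`. -/
noncomputable def semigroup {N : ℕ} (a b : Fin (N + 1) → ℝ) (t : ℝ≥0) :
    (Config N →ᵇ ℝ) →L[ℝ] (Config N →ᵇ ℝ) :=
  opSemigroup (generator a b) t

/-- `X` is a version, on the probability space `(Ω, P)`, of the exclusion process with left jump
rates `a` and right jump rates `b` started from the configuration `x₀`: the right-continuous,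
time-homogeneous continuous-time Markov chain on `Config N` with generator `generator a b` and
`X 0 = x₀`. The Markov property is with respect to the natural filtration of `X`. -/
structure IsExclusionProcess {N : ℕ} (a b : Fin (N + 1) → ℝ) (x₀ : Config N)
    {Ω : Type*} [MeasurableSpace Ω] (P : Measure Ω) (X : ℝ≥0 → Ω → Config N) : Prop where
  measurable : ∀ t, Measurable (X t)
  initial : ∀ᵐ ω ∂P, X 0 ω = x₀
  right_continuous : ∀ᵐ ω ∂P, ∀ t, ContinuousWithinAt (fun s => X s ω) (Set.Ici t) t
  markov : ∀ (s t : ℝ≥0) (f : Config N →ᵇ ℝ),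
    P[fun ω => f (X (s + t) ω) | ⨆ r : Set.Iic s, MeasurableSpace.comap (X r) inferInstance]
      =ᵐ[P] fun ω => semigroup a b t f (X s ω)

/-- `(a_1 ⋯ a_k) / (b_1 ⋯ b_k)`. -/
noncomputable def alphaCoeff {N : ℕ} (a b : Fin (N + 1) → ℝ) (k : Fin (N + 1)) : ℝ :=
  (∏ u ∈ Finset.Iic k, a u) / ∏ u ∈ Finset.Iic k, b u

/-- `1 / b_k + a_k / (b_k b_{k-1}) + ⋯ + (a_k ⋯ a_2) / (b_k ⋯ b_1)`; the summand for `j` is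
`(a_k ⋯ a_{j+1}) / (b_k ⋯ b_j)`. -/
noncomputable def betaCoeff {N : ℕ} (a b : Fin (N + 1) → ℝ) (k : Fin (N + 1)) : ℝ :=
  ∑ j ∈ Finset.Iic k, (∏ u ∈ Finset.Ioc j k, a u) / ∏ u ∈ Finset.Icc j k, b u

/-- The speed of the whole system. -/
noncomputable def speed {N : ℕ} (a b : Fin (N + 1) → ℝ) : ℝ :=
  (1 - alphaCoeff a b (Fin.last N)) / betaCoeff a b (Fin.last N)

/-- The load of gap `i`, that is, of the gap between the particles `i` and `i + 1`. -/
noncomputable def load {N : ℕ} (a b : Fin (N + 1) → ℝ) (i : Fin N) : ℝ :=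
  alphaCoeff a b i.castSucc + betaCoeff a b i.castSucc * speed a b

end Exclusion

/-!
The law of the process at time `t` is given by its semigroup, `𝔼 f (X t) = (exp (t L) f) x₀`, so
everything is a statement about exponentials of bounded operators on bounded functions.

*The gaps.* The gap vector is itself a jump process, in which a jump of particle `i` carries an
empty site between the gaps on its two sides. The loads, extended by the value `1` to the
unbounded regions to the left and to the right of all particles, solve the traffic equations
`b i * ρ (i + 1) - a i * ρ i = speed` (`extLoad_flow`), and hence the product of geometric
distributions is stationary (`mean_jumpGen_gapJump`). Jumps to the right alone connect all gap
vectors. In stationarity the squared `L²` norm of `exp (t L) f` decreases at a rate given by its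
squared increments along jumps, which therefore tend to zero; this yields convergence to
equilibrium from every initial state (`tendsto_flow_jumpGen_mean`).

*The fluctuations.* There are nonnegative weights `c` of sum one with
`c i * b i = c (i + 1) * a (i + 1)` (`exists_weights`). The drift of the weighted mean position `∑ i, c i * X i` does not
depend on the gaps: the blocking terms cancel. Hence `∑ i, c i * X i - speed * t` is a martingale
with bounded jumps, and its squared jumps occur at a rate which is a function of the gaps. A
slowly varying function of it decouples asymptotically from functions of the gaps, which relax in
bounded time (`exists_decoupling`). Consequently its characteristic function at frequency `θ / √t`
solves the ordinary differential equation of a Gaussian characteristic function up to a vanishing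
error (`tendsto_flow_wave`), and the limit is independent of the gaps (`tendsto_flow_wave_mul`).
The limiting variance is the stationary mean of the rate of squared jumps; it is positive since
the last particle is never blocked on its right.

*Conclusion.* Each particle is at a distance from the weighted mean position which is a function
of the gaps (`pos_eq_weightedPos_add_offset`). Given the gaps this distance is a constant, and
Lévy's continuity theorem gives the joint limit (`tendsto_joint`); since the gaps are tight,
Slutsky's theorem gives the limit of the vector of all positions (`tendstoInDistribution_pos`).
-/

namespace Exclusion

/-! ### Exponentials of bounded operators -/

section Flow

variable {E F : Type*} [NormedAddCommGroup E] [NormedSpace ℝ E] [CompleteSpace E]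
  [NormedAddCommGroup F] [NormedSpace ℝ F] [CompleteSpace F]

/-- The one-parameter group `exp (t A)` generated by a bounded operator `A`, for real times `t`. -/
noncomputable def flow (A : E →L[ℝ] E) (t : ℝ) : E →L[ℝ] E :=
  NormedSpace.exp (t • A)

omit [CompleteSpace E] in
theorem flow_zero (A : E →L[ℝ] E) : flow A 0 = 1 := by
  simp [flow]

theorem flow_add (A : E →L[ℝ] E) (s t : ℝ) : flow A (s + t) = flow A s * flow A t := by
  have : NormedAlgebra ℚ (E →L[ℝ] E) := NormedAlgebra.restrictScalars ℚ ℝ _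
  rw [flow, add_smul]
  exact NormedSpace.exp_add_of_commute (((Commute.refl A).smul_left s).smul_right t)

theorem flow_add_apply (A : E →L[ℝ] E) (s t : ℝ) (f : E) :
    flow A (s + t) f = flow A s (flow A t f) := by
  rw [flow_add]; rfl

theorem hasDerivAt_flow (A : E →L[ℝ] E) (t : ℝ) :
    HasDerivAt (flow A) (flow A t * A) t :=
  hasDerivAt_exp_smul_const A t

theorem hasDerivAt_flow' (A : E →L[ℝ] E) (t : ℝ) :
    HasDerivAt (flow A) (A * flow A t) t :=
  hasDerivAt_exp_smul_const' A t

theorem hasDerivAt_flow_apply (A : E →L[ℝ] E) (f : E) (t : ℝ) :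
    HasDerivAt (fun t => flow A t f) (A (flow A t f)) t := by
  simpa using (hasDerivAt_flow' A t).clm_apply (hasDerivAt_const t f)

omit [CompleteSpace F] in
theorem map_flow_apply_of_map_eq_zero (A : E →L[ℝ] E) (T : E →L[ℝ] F) (h : ∀ f, T (A f) = 0)
    (t : ℝ) (f : E) : T (flow A t f) = T f := by
  have hd : ∀ s, HasDerivAt (fun s => T (flow A s f)) 0 s := fun s => by
    have := (T.hasFDerivAt (x := flow A s f)).comp_hasDerivAt s (hasDerivAt_flow_apply A f s)
    rwa [h] at this
  have := is_const_of_deriv_eq_zero (fun s => (hd s).differentiableAt) (fun s => (hd s).deriv) t 0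
  simpa [flow_zero] using this

theorem flow_apply_of_apply_eq_zero (A : E →L[ℝ] E) {f : E} (h : A f = 0) (t : ℝ) :
    flow A t f = f := by
  have hd : ∀ s, HasDerivAt (fun s => flow A s f) 0 s := fun s => by
    have := (hasDerivAt_flow A s).clm_apply (hasDerivAt_const s f)
    simpa [h] using this
  have := is_const_of_deriv_eq_zero (fun s => (hd s).differentiableAt) (fun s => (hd s).deriv) t 0
  simpa [flow_zero] using this

/-- An operator intertwining two bounded generators intertwines their exponentials: the map
`s ↦ exp (s A) J exp ((t - s) B)` has derivative zero. -/
theorem flow_intertwine (A : E →L[ℝ] E) (B : F →L[ℝ] F) (J : F →L[ℝ] E)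
    (h : ∀ f, A (J f) = J (B f)) (t : ℝ) (f : F) : flow A t (J f) = J (flow B t f) := by
  have hd : ∀ s, HasDerivAt (fun s => flow A s (J (flow B (t - s) f))) 0 s := fun s => by
    have h1 : HasDerivAt (fun s => flow B (t - s) f) (-(B (flow B (t - s) f))) s := by
      have := HasDerivAt.scomp s (hasDerivAt_flow_apply B f (t - s))
        ((hasDerivAt_id s).const_sub t)
      rwa [neg_one_smul] at this
    have h2 := (J.hasFDerivAt (x := flow B (t - s) f)).comp_hasDerivAt s h1
    have h3 := (hasDerivAt_flow A s).clm_apply h2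
    simpa [h] using h3
  have := is_const_of_deriv_eq_zero (fun s => (hd s).differentiableAt) (fun s => (hd s).deriv) t 0
  simpa [flow_zero] using this

omit [CompleteSpace E] in
theorem norm_flow_le (A : E →L[ℝ] E) {t : ℝ} (ht : 0 ≤ t) : ‖flow A t‖ ≤ Real.exp (t * ‖A‖) := by
  have h1 : HasSum (fun n : ℕ => (n.factorial⁻¹ : ℝ) • (t * ‖A‖) ^ n) (Real.exp (t * ‖A‖)) := by
    rw [Real.exp_eq_exp_ℝ]
    exact NormedSpace.exp_series_hasSum_exp' (𝕂 := ℝ) (t * ‖A‖)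
  have h2 : flow A t = ∑' n : ℕ, (n.factorial⁻¹ : ℝ) • (t • A) ^ n := by
    rw [flow, NormedSpace.exp_eq_tsum ℝ]
  rw [h2]
  refine tsum_of_norm_bounded h1 fun n => ?_
  rw [norm_smul, Real.norm_of_nonneg (by positivity), smul_eq_mul]
  gcongr
  rcases n.eq_zero_or_pos with rfl | hn
  · rw [pow_zero, pow_zero]
    exact ContinuousLinearMap.norm_id_le
  · refine (norm_pow_le' _ hn).trans ?_
    rw [norm_smul, Real.norm_of_nonneg ht]

theorem flow_sub_smul_one (A : E →L[ℝ] E) (c t : ℝ) :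
    flow (A - c • 1) t = Real.exp (-(t * c)) • flow A t := by
  have h : ∀ s, HasDerivAt
      (fun s => Real.exp (s * c) • (flow (A - c • 1) s * flow A (t - s))) 0 s := fun s => by
    have h1 : HasDerivAt (fun s => flow A (t - s)) (-(A * flow A (t - s))) s := by
      have := HasDerivAt.scomp s (hasDerivAt_flow' A (t - s))
        ((hasDerivAt_id s).const_sub t)
      rwa [neg_one_smul] at this
    have h2 : HasDerivAt (fun s => Real.exp (s * c)) (Real.exp (s * c) * c) s := by
      simpa using ((hasDerivAt_id s).mul_const c).exp
    have h3 := h2.smul ((hasDerivAt_flow (A - c • 1) s).mul h1)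
    refine h3.congr_deriv ?_
    simp only [mul_sub, sub_mul, mul_smul_comm, smul_mul_assoc, mul_neg, mul_one, mul_assoc]
    module
  have h0 := is_const_of_deriv_eq_zero (fun s => (h s).differentiableAt) (fun s => (h s).deriv) t 0
  simp only [sub_self, flow_zero, mul_one, zero_mul, Real.exp_zero, sub_zero, one_smul,
    one_mul] at h0
  rw [← h0, smul_smul, ← Real.exp_add]
  simp

/-- For a contraction semigroup, the commutator of `exp (t A)` with a bounded operator `M` grows at
most linearly in time, by Duhamel's formula. -/
theorem norm_commutator_flow_le (A M : E →L[ℝ] E) (hA : ∀ t, 0 ≤ t → ‖flow A t‖ ≤ 1) {t : ℝ}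
    (ht : 0 ≤ t) : ‖flow A t * M - M * flow A t‖ ≤ ‖A * M - M * A‖ * t := by
  have hd : ∀ s, HasDerivAt (fun s => flow A s * M * flow A (t - s))
      (flow A s * (A * M - M * A) * flow A (t - s)) s := fun s => by
    have h1 : HasDerivAt (fun s => flow A (t - s)) (-(A * flow A (t - s))) s := by
      have := HasDerivAt.scomp s (hasDerivAt_flow' A (t - s))
        ((hasDerivAt_id s).const_sub t)
      rwa [neg_one_smul] at this
    have h2 := ((hasDerivAt_flow A s).mul_const M).mul h1
    have h3 : flow A s * (A * M - M * A) * flow A (t - s)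
        = flow A s * A * M * flow A (t - s) + flow A s * M * -(A * flow A (t - s)) := by
      noncomm_ring
    rw [h3]
    exact h2
  have key := norm_image_sub_le_of_norm_deriv_le_segment' (a := 0) (b := t)
    (C := ‖A * M - M * A‖) (fun s _ => (hd s).hasDerivWithinAt) ?_ t ⟨ht, le_rfl⟩
  · simpa [flow_zero] using key
  · intro s hs
    calc _ ≤ ‖flow A s‖ * ‖A * M - M * A‖ * ‖flow A (t - s)‖ :=
          (norm_mul_le _ _).trans (by gcongr; exact norm_mul_le _ _)
      _ ≤ 1 * ‖A * M - M * A‖ * 1 := by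
          gcongr
          · exact hA s hs.1
          · exact hA (t - s) (by linarith [hs.2])
      _ = _ := by ring

end Flow

/-! ### Generators of jump processes -/

section JumpGen

variable {S T : Type*} [TopologicalSpace S] [DiscreteTopology S]
  [TopologicalSpace T] [DiscreteTopology T] {ι : Type*} [Fintype ι]

/-- Composition `f ↦ f ∘ φ` as a bounded operator between spaces of bounded functions on discrete
spaces. -/
noncomputable def pullback (φ : S → T) : (T →ᵇ ℝ) →L[ℝ] (S →ᵇ ℝ) :=
  BoundedContinuousFunction.compContinuousCLM ℝ ℝ ⟨φ, continuous_of_discreteTopology⟩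

omit [DiscreteTopology T] in
@[simp]
theorem pullback_apply (φ : S → T) (f : T →ᵇ ℝ) (x : S) : pullback φ f x = f (φ x) := rfl

/-- The generator `(L f) x = ∑ i, r i * (f (σ i x) - f x)` of the pure jump process which applies
the map `σ i` at rate `r i`. -/
noncomputable def jumpGen (r : ι → ℝ) (σ : ι → S → S) : (S →ᵇ ℝ) →L[ℝ] (S →ᵇ ℝ) :=
  ∑ i, r i • (pullback (σ i) - 1)

theorem jumpGen_apply (r : ι → ℝ) (σ : ι → S → S) (f : S →ᵇ ℝ) (x : S) :
    jumpGen r σ f x = ∑ i, r i * (f (σ i x) - f x) := by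
  simp [jumpGen, BoundedContinuousFunction.coe_sum]

omit [DiscreteTopology T] in
theorem norm_pullback_le (φ : S → T) : ‖pullback φ‖ ≤ 1 :=
  ContinuousLinearMap.opNorm_le_bound _ zero_le_one fun f => by
    rw [one_mul, BoundedContinuousFunction.norm_le (norm_nonneg f)]
    exact fun x => f.norm_coe_le_norm _

variable {r : ι → ℝ} (hr : ∀ i, 0 ≤ r i) (σ : ι → S → S)
include hr

theorem norm_flow_jumpGen_le {t : ℝ} (ht : 0 ≤ t) : ‖flow (jumpGen r σ) t‖ ≤ 1 := by
  -- `exp (t L) = exp (-t R) exp (t ∑ i, r i C_i)`, with `R` the total rate and `C_i` contractions.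
  have hL : jumpGen r σ = (∑ i, r i • pullback (σ i)) - (∑ i, r i) • 1 := by
    ext f x
    simp [jumpGen_apply, BoundedContinuousFunction.coe_sum, mul_sub, Finset.sum_mul]
  have hK : ‖∑ i, r i • pullback (S := S) (σ i)‖ ≤ ∑ i, r i := by
    refine (norm_sum_le Finset.univ fun i => r i • pullback (S := S) (σ i)).trans
      (Finset.sum_le_sum fun i _ => ?_)
    refine (ContinuousLinearMap.opNorm_smul_le (r i) (pullback (S := S) (σ i))).trans ?_
    rw [Real.norm_of_nonneg (hr i)]
    exact mul_le_of_le_one_right (hr i) (norm_pullback_le _)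
  rw [hL, flow_sub_smul_one, norm_smul, Real.norm_of_nonneg (Real.exp_pos _).le]
  calc _ ≤ Real.exp (-(t * ∑ i, r i)) * Real.exp (t * ∑ i, r i) := by
        gcongr
        refine (norm_flow_le _ ht).trans ?_
        gcongr
    _ = 1 := by rw [← Real.exp_add]; simp

omit hr in
theorem jumpGen_const (c : ℝ) : jumpGen r σ (BoundedContinuousFunction.const S c) = 0 := by
  ext x
  simp [jumpGen_apply]

omit hr in
theorem flow_jumpGen_const (c : ℝ) (t : ℝ) :
    flow (jumpGen r σ) t (BoundedContinuousFunction.const S c)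
      = BoundedContinuousFunction.const S c :=
  flow_apply_of_apply_eq_zero _ (jumpGen_const σ c) t

theorem norm_flow_jumpGen_apply_le {t : ℝ} (ht : 0 ≤ t) (f : S →ᵇ ℝ) :
    ‖flow (jumpGen r σ) t f‖ ≤ ‖f‖ := by
  simpa using (flow (jumpGen r σ) t).le_of_opNorm_le (norm_flow_jumpGen_le hr σ ht) f

/-- A contraction semigroup preserving constants is positive: if `0 ≤ f ≤ 2 c` then
`‖f - c‖ ≤ c`. -/
theorem flow_jumpGen_nonneg {t : ℝ} (ht : 0 ≤ t) {f : S →ᵇ ℝ} (hf : ∀ x, 0 ≤ f x) (x : S) :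
    0 ≤ flow (jumpGen r σ) t f x := by
  have h1 : ‖f - BoundedContinuousFunction.const S ‖f‖‖ ≤ ‖f‖ := by
    rw [BoundedContinuousFunction.norm_le (norm_nonneg f)]
    intro y
    have := (Real.norm_eq_abs _ ▸ f.norm_coe_le_norm y)
    simp only [BoundedContinuousFunction.coe_sub, Pi.sub_apply,
      BoundedContinuousFunction.const_apply, Real.norm_eq_abs]
    rw [abs_le] at this ⊢
    constructor <;> linarith [hf y]
  have h2 := (BoundedContinuousFunction.norm_coe_le_norm _ x).trans
    ((norm_flow_jumpGen_apply_le hr σ ht _).trans h1)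
  rw [map_sub, flow_jumpGen_const, Real.norm_eq_abs, abs_le] at h2
  simp at h2
  linarith

theorem abs_flow_jumpGen_le {t : ℝ} (ht : 0 ≤ t) {f g : S →ᵇ ℝ} (h : ∀ x, |f x| ≤ g x) (x : S) :
    |flow (jumpGen r σ) t f x| ≤ flow (jumpGen r σ) t g x := by
  have h1 := flow_jumpGen_nonneg hr σ ht (f := g - f)
    (fun y => by simpa using (le_abs_self _).trans (h y)) x
  have h2 := flow_jumpGen_nonneg hr σ ht (f := g + f)
    (fun y => by simpa using neg_le_iff_add_nonneg.1 ((neg_le_abs _).trans (h y))) x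
  rw [map_sub] at h1
  rw [map_add] at h2
  simp at h1 h2
  rw [abs_le]
  constructor <;> linarith

/-- Multiplication by a function that varies little along the jumps nearly commutes with the
generator. -/
theorem norm_commutator_jumpGen_mul_le (f : S →ᵇ ℝ) {δ : ℝ} (hδ : 0 ≤ δ)
    (hf : ∀ i x, |f (σ i x) - f x| ≤ δ) :
    ‖jumpGen r σ * ContinuousLinearMap.mul ℝ (S →ᵇ ℝ) f
      - ContinuousLinearMap.mul ℝ (S →ᵇ ℝ) f * jumpGen r σ‖ ≤ (∑ i, r i) * δ := by
  have hR : 0 ≤ ∑ i, r i := Finset.sum_nonneg fun i _ => hr i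
  refine ContinuousLinearMap.opNorm_le_bound _ (by positivity) fun g => ?_
  rw [BoundedContinuousFunction.norm_le (by positivity)]
  intro x
  have : (jumpGen r σ * ContinuousLinearMap.mul ℝ (S →ᵇ ℝ) f
      - ContinuousLinearMap.mul ℝ (S →ᵇ ℝ) f * jumpGen r σ) g x
      = ∑ i, r i * ((f (σ i x) - f x) * g (σ i x)) := by
    change jumpGen r σ (f * g) x - f x * jumpGen r σ g x = _
    simp only [BoundedContinuousFunction.coe_mul, Pi.mul_apply,
      jumpGen_apply, Finset.mul_sum, ← Finset.sum_sub_distrib]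
    exact Finset.sum_congr rfl fun i _ => by ring
  rw [this, Finset.sum_mul, Finset.sum_mul]
  refine (norm_sum_le _ _).trans (Finset.sum_le_sum fun i _ => ?_)
  rw [norm_mul, norm_mul, Real.norm_of_nonneg (hr i), mul_assoc]
  gcongr
  · exact hr i
  · exact hf i x
  · exact g.norm_coe_le_norm _

end JumpGen

/-! ### Ergodicity of jump processes with a stationary distribution -/

/-- Barbalat's lemma: if `h` is nonincreasing and bounded below, and its derivative `k` is
Lipschitz, then `k` tends to zero. -/
theorem tendsto_deriv_zero_of_antitone {h k m : ℝ → ℝ} {c C : ℝ} (hh : ∀ t, HasDerivAt h (k t) t)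
    (hk : ∀ t, HasDerivAt k (m t) t) (hm : ∀ t, 0 ≤ t → |m t| ≤ C) (hneg : ∀ t, k t ≤ 0)
    (hc : ∀ t, c ≤ h t) : Tendsto k atTop (𝓝 0) := by
  have hanti : Antitone h :=
    antitone_of_deriv_nonpos (fun t => (hh t).differentiableAt) fun t => by
      rw [(hh t).deriv]; exact hneg t
  have hlim := tendsto_atTop_ciInf hanti ⟨c, by rintro _ ⟨t, rfl⟩; exact hc t⟩
  have hC : 0 ≤ C := (abs_nonneg _).trans (hm 0 le_rfl)
  rw [Metric.tendsto_atTop]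
  intro ε hε
  -- On a time step of length `δ` the derivative changes by at most `ε / 2`.
  obtain ⟨δ, hδ, hδC⟩ : ∃ δ > 0, C * δ < ε / 2 := by
    refine ⟨ε / 2 / (C + 1), by positivity, ?_⟩
    rw [mul_div_assoc', div_lt_iff₀ (by positivity)]
    nlinarith
  have hd : Tendsto (fun t => h t - h (t + δ)) atTop (𝓝 0) := by
    simpa using hlim.sub (hlim.comp (tendsto_atTop_add_const_right _ δ tendsto_id))
  obtain ⟨t₀, ht₀⟩ := Metric.tendsto_atTop.1 hd (δ * (ε / 2)) (by positivity)
  refine ⟨max t₀ 0, fun t ht => ?_⟩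
  have ht0 : 0 ≤ t := (le_max_right _ _).trans ht
  obtain ⟨ξ, hξ, hξ'⟩ := exists_hasDerivAt_eq_slope h k (show t < t + δ by linarith)
    (fun x _ => (hh x).continuousAt.continuousWithinAt) fun x _ => hh x
  have h1 := ht₀ t ((le_max_left _ _).trans ht)
  rw [Real.dist_eq, sub_zero] at h1 ⊢
  have h2 : |k ξ - k t| ≤ C * (ξ - t) := by
    have := norm_image_sub_le_of_norm_deriv_le_segment' (a := t) (b := ξ) (C := C)
      (fun s _ => (hk s).hasDerivWithinAt)
      (fun s hs => hm s (ht0.trans hs.1)) ξ ⟨hξ.1.le, le_rfl⟩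
    simpa using this
  have h3 : C * (ξ - t) ≤ C * δ := by gcongr; linarith [hξ.2]
  have h4 : |k ξ| < ε / 2 := by
    rw [hξ', abs_div, add_sub_cancel_left, abs_of_pos hδ, div_lt_iff₀ hδ, abs_sub_comm]
    linarith
  calc |k t| = |k ξ - (k ξ - k t)| := by ring_nf
    _ ≤ |k ξ| + |k ξ - k t| := abs_sub _ _
    _ < ε := by linarith

section Ergodic

variable {S : Type*} [TopologicalSpace S] [DiscreteTopology S] [MeasurableSpace S]
  [DiscreteMeasurableSpace S] {ι : Type*} [Fintype ι]

/-- Integration against a probability measure, as a bounded functional. -/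
noncomputable def mean (π : Measure S) [IsProbabilityMeasure π] : (S →ᵇ ℝ) →L[ℝ] ℝ :=
  LinearMap.mkContinuous
    { toFun := fun f => ∫ x, f x ∂π
      map_add' := fun f g => integral_add (f.integrable π) (g.integrable π)
      map_smul' := fun c f => integral_const_mul c f } 1 fun f => by
    simpa using f.norm_integral_le_norm π

theorem mean_apply (π : Measure S) [IsProbabilityMeasure π] (f : S →ᵇ ℝ) :
    mean π f = ∫ x, f x ∂π := rfl

theorem abs_mean_le (π : Measure S) [IsProbabilityMeasure π] (f : S →ᵇ ℝ) : |mean π f| ≤ ‖f‖ := by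
  simpa [mean_apply] using f.norm_integral_le_norm π

variable {r : ι → ℝ} (hr : ∀ i, 0 ≤ r i) (σ : ι → S → S) (π : Measure S) [IsProbabilityMeasure π]

/-- The expected squared increment of `f` along a jump of the process, in stationarity: the
Dirichlet form of the generator. -/
noncomputable def energy (r : ι → ℝ) (σ : ι → S → S) (π : Measure S) (f : S →ᵇ ℝ) : ℝ :=
  ∫ x, ∑ i, r i * (f (σ i x) - f x) ^ 2 ∂π

variable (hπ : ∀ f : S →ᵇ ℝ, mean π (jumpGen r σ f) = 0)
include hπ

theorem mean_mul_jumpGen (f : S →ᵇ ℝ) : 2 * mean π (f * jumpGen r σ f) = - energy r σ π f := by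
  have h : (jumpGen r σ (f * f) - (2 : ℝ) • (f * jumpGen r σ f) : S →ᵇ ℝ)
      = fun x => ∑ i, r i * (f (σ i x) - f x) ^ 2 := by
    ext x
    simp only [BoundedContinuousFunction.coe_sub, BoundedContinuousFunction.coe_smul,
      BoundedContinuousFunction.coe_mul, Pi.sub_apply, Pi.mul_apply, jumpGen_apply,
      Finset.mul_sum, smul_eq_mul, ← Finset.sum_sub_distrib]
    exact Finset.sum_congr rfl fun i _ => by ring
  rw [energy, ← h, ← mean_apply, map_sub, hπ, map_smul]
  simp

include hr

omit hπ [DiscreteTopology S] [DiscreteMeasurableSpace S] [IsProbabilityMeasure π] in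
theorem energy_nonneg (f : S →ᵇ ℝ) : 0 ≤ energy r σ π f :=
  integral_nonneg fun _ => Finset.sum_nonneg fun i _ => mul_nonneg (hr i) (sq_nonneg _)

omit hπ in
theorem le_energy (f : S →ᵇ ℝ) (i : ι) (x : S) :
    π.real {x} * (r i * (f (σ i x) - f x) ^ 2) ≤ energy r σ π f := by
  let g : S →ᵇ ℝ := ∑ j, r j • ((pullback (σ j) f - f) * (pullback (σ j) f - f))
  have hg : ∀ y, g y = ∑ j, r j * (f (σ j y) - f y) ^ 2 := fun y => by
    simp [g, BoundedContinuousFunction.coe_sum, sq]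
  have hg0 : ∀ y, 0 ≤ g y := fun y => by
    rw [hg]; exact Finset.sum_nonneg fun j _ => mul_nonneg (hr j) (sq_nonneg _)
  calc _ ≤ π.real {x} * g x := by
        rw [hg]
        gcongr
        exact Finset.single_le_sum (f := fun j => r j * (f (σ j x) - f x) ^ 2)
          (fun j _ => mul_nonneg (hr j) (sq_nonneg _)) (Finset.mem_univ i)
    _ = ∫ y in {x}, g y ∂π := by
        rw [integral_singleton]; rfl
    _ ≤ ∫ y, g y ∂π := setIntegral_le_integral (g.integrable π) (Eventually.of_forall hg0)
    _ = energy r σ π f := by simp_rw [hg]; rfl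

/-- In stationarity, `d/dt ‖P_t f‖²` is minus the energy of `P_t f`, so the energy tends to
zero. -/
theorem tendsto_energy_flow (f : S →ᵇ ℝ) :
    Tendsto (fun t => energy r σ π (flow (jumpGen r σ) t f)) atTop (𝓝 0) := by
  set L := jumpGen r σ
  set u : ℝ → S →ᵇ ℝ := fun t => flow L t f
  have hu : ∀ t, HasDerivAt u (L (u t)) t := fun t => hasDerivAt_flow_apply L f t
  have hLu : ∀ t, HasDerivAt (fun t => L (u t)) (L (L (u t))) t := fun t =>
    (L.hasFDerivAt (x := u t)).comp_hasDerivAt t (hu t)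
  have h1 : ∀ t, HasDerivAt (fun t => mean π (u t * u t)) (2 * mean π (u t * L (u t))) t :=
    fun t => by
    have := ((mean π).hasFDerivAt (x := u t * u t)).comp_hasDerivAt t ((hu t).mul (hu t))
    refine this.congr_deriv ?_
    rw [map_add, mul_comm (L (u t)), two_mul]
  have h2 : ∀ t, HasDerivAt (fun t => 2 * mean π (u t * L (u t)))
      (2 * mean π (L (u t) * L (u t) + u t * L (L (u t)))) t := fun t =>
    (((mean π).hasFDerivAt (x := u t * L (u t))).comp_hasDerivAt t
      ((hu t).mul (hLu t))).const_mul 2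
  have h3 := tendsto_deriv_zero_of_antitone (c := 0)
    (C := 2 * ((‖L‖ * ‖f‖) * (‖L‖ * ‖f‖) + ‖f‖ * (‖L‖ * (‖L‖ * ‖f‖)))) h1 h2
    (fun t ht => ?_) (fun t => ?_) (fun t => ?_)
  · simpa using (h3.congr fun t => mean_mul_jumpGen σ π hπ (u t)).neg
  · have hut : ‖u t‖ ≤ ‖f‖ := norm_flow_jumpGen_apply_le hr σ ht f
    have hL : ‖L (u t)‖ ≤ ‖L‖ * ‖f‖ := (L.le_opNorm _).trans (by gcongr)
    have hLL : ‖L (L (u t))‖ ≤ ‖L‖ * (‖L‖ * ‖f‖) := (L.le_opNorm _).trans (by gcongr)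
    rw [abs_mul, abs_two]
    gcongr
    refine (abs_mean_le π _).trans ((norm_add_le _ _).trans ?_)
    gcongr
    · exact (norm_mul_le _ _).trans (by gcongr)
    · exact (norm_mul_le _ _).trans (by gcongr)
  · rw [mean_mul_jumpGen σ π hπ]
    exact neg_nonpos.2 (energy_nonneg hr σ π _)
  · exact integral_nonneg fun x => mul_self_nonneg _

/-- **Ergodic theorem**: a jump process whose stationary distribution charges every state, and whose
states are all connected by (undirected) paths of possible jumps, forgets its initial state. The
energy of `P_t f` vanishes as `t → ∞`, so that `P_t f` becomes constant along edges; its mean under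
the stationary distribution is preserved. -/
theorem tendsto_flow_jumpGen_mean (hpos : ∀ x, π.real {x} ≠ 0)
    (hconn : ∀ x y, Relation.EqvGen (fun x y => ∃ i, 0 < r i ∧ y = σ i x) x y)
    (f : S →ᵇ ℝ) (x : S) :
    Tendsto (fun t => flow (jumpGen r σ) t f x) atTop (𝓝 (mean π f)) := by
  set u : ℝ → S →ᵇ ℝ := fun t => flow (jumpGen r σ) t f
  have hedge : ∀ x y, (∃ i, 0 < r i ∧ y = σ i x) →
      Tendsto (fun t => u t x - u t y) atTop (𝓝 0) := by
    rintro x _ ⟨i, hi, rfl⟩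
    have hc : 0 < π.real {x} * r i := mul_pos (lt_of_le_of_ne measureReal_nonneg (hpos x).symm) hi
    have h1 : Tendsto (fun t => (u t x - u t (σ i x)) ^ 2) atTop (𝓝 0) := by
      have h0 := (tendsto_energy_flow hr σ π hπ f).const_mul (π.real {x} * r i)⁻¹
      rw [mul_zero] at h0
      refine squeeze_zero (fun t => sq_nonneg _) (fun t => ?_) h0
      rw [inv_mul_eq_div, le_div_iff₀ hc]
      calc _ = π.real {x} * (r i * (u t (σ i x) - u t x) ^ 2) := by ring
        _ ≤ _ := le_energy hr σ π _ i x
    have h2 := h1.sqrt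
    simp only [Real.sqrt_sq_eq_abs, Real.sqrt_zero] at h2
    exact (tendsto_zero_iff_abs_tendsto_zero _).2 h2
  have hall : ∀ x y, Tendsto (fun t => u t x - u t y) atTop (𝓝 0) := fun x y => by
    induction hconn x y with
    | rel x y h => exact hedge x y h
    | refl x => simp
    | symm x y _ ih => simpa using ih.neg
    | trans x y z _ _ ih₁ ih₂ => simpa using ih₁.add ih₂
  have hlim : Tendsto (fun t => ∫ y, (u t x - u t y) ∂π) atTop (𝓝 (∫ _, (0 : ℝ) ∂π)) := by
    refine tendsto_integral_filter_of_dominated_convergence (fun _ => 2 * ‖f‖)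
      (Eventually.of_forall fun t => Measurable.of_discrete.aestronglyMeasurable) ?_
      (integrable_const _) (Eventually.of_forall fun y => hall x y)
    filter_upwards [eventually_ge_atTop 0] with t ht
    refine Eventually.of_forall fun y => ?_
    refine ((u t).dist_le_two_norm x y).trans ?_
    gcongr
    exact norm_flow_jumpGen_apply_le hr σ ht f
  have hmean : ∀ t, ∫ y, (u t x - u t y) ∂π = u t x - mean π f := fun t => by
    rw [integral_sub (integrable_const _) ((u t).integrable π), ← mean_apply,
      map_flow_apply_of_map_eq_zero _ (mean π) hπ]
    simp
  simp_rw [hmean] at hlim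
  simpa using hlim.add_const (mean π f)

end Ergodic

/-! ### A central limit theorem for additive functionals -/

theorem abs_cos_add_sub_le {y h : ℝ} (hh : |h| ≤ 1) :
    |Real.cos (y + h) - Real.cos y + h * Real.sin y + h ^ 2 / 2 * Real.cos y| ≤ |h| ^ 3 := by
  have h1 := Real.cos_bound hh
  have h2 := Real.sin_bound hh
  have h4 : |h| ^ 4 ≤ |h| ^ 3 := pow_le_pow_of_le_one (abs_nonneg h) hh (by norm_num)
  have h5 : |h| ^ 5 ≤ |h| ^ 3 := pow_le_pow_of_le_one (abs_nonneg h) hh (by norm_num)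
  have h3 : |Real.sin h - h| ≤ |h| ^ 3 * (1 / 4) := by
    calc |Real.sin h - h| = |(Real.sin h - (h - h ^ 3 / 6)) - h ^ 3 / 6| := by ring_nf
      _ ≤ |h| ^ 5 / 100 + |h ^ 3 / 6| := (abs_sub _ _).trans (by gcongr)
      _ = |h| ^ 5 / 100 + |h| ^ 3 / 6 := by rw [abs_div, abs_pow]; norm_num
      _ ≤ _ := by linarith [pow_nonneg (abs_nonneg h) 3]
  have hc := Real.abs_cos_le_one y
  have hs := Real.abs_sin_le_one y
  calc _ = |Real.cos y * (Real.cos h - (1 - h ^ 2 / 2)) - Real.sin y * (Real.sin h - h)| := by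
        rw [Real.cos_add]; ring_nf
    _ ≤ |Real.cos y| * |Real.cos h - (1 - h ^ 2 / 2)| + |Real.sin y| * |Real.sin h - h| := by
        rw [← abs_mul, ← abs_mul]; exact abs_sub _ _
    _ ≤ 1 * (|h| ^ 4 * (5 / 96)) + 1 * (|h| ^ 3 * (1 / 4)) := by gcongr
    _ ≤ _ := by linarith [pow_nonneg (abs_nonneg h) 3]

/-- A function nearly solving `u' = -c u` on `[p, q]` nearly decays exponentially. -/
theorem abs_sub_exp_mul_le {u u' : ℝ → ℝ} {c δ p q : ℝ} (hc : 0 ≤ c) (hpq : p ≤ q)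
    (hu : ∀ t, HasDerivAt u (u' t) t) (hδ : ∀ t ∈ Set.Ico p q, |u' t + c * u t| ≤ δ) :
    |u q - Real.exp (-(c * (q - p))) * u p| ≤ δ * (q - p) := by
  have hw : ∀ t, HasDerivAt (fun t => Real.exp (-(c * (q - t))) * u t)
      (Real.exp (-(c * (q - t))) * (u' t + c * u t)) t := fun t => by
    have h1 : HasDerivAt (fun t => -(c * (q - t))) c t := by
      exact (((hasDerivAt_id t).const_sub q).const_mul c).neg.congr_deriv (by ring)
    exact (h1.exp.mul (hu t)).congr_deriv (by ring)
  have := norm_image_sub_le_of_norm_deriv_le_segment' (a := p) (b := q) (C := δ)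
    (fun t _ => (hw t).hasDerivWithinAt) (fun t ht => ?_) q ⟨hpq, le_rfl⟩
  · simpa using this
  · rw [norm_mul, Real.norm_of_nonneg (Real.exp_pos _).le]
    refine (mul_le_of_le_one_left (norm_nonneg _) ?_).trans (hδ t ht)
    rw [Real.exp_le_one_iff]
    have := mul_nonneg hc (sub_nonneg.2 ht.2.le)
    linarith

section Additive

variable {S G : Type*} [TopologicalSpace S] [DiscreteTopology S]
  [TopologicalSpace G] [DiscreteTopology G] [MeasurableSpace G] [DiscreteMeasurableSpace G]
  {ι : Type*} [Fintype ι] {r : ι → ℝ} (hr : ∀ i, 0 ≤ r i) (σ : ι → S → S) (τ : ι → G → G)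
  (γ : S → G) (hγ : ∀ i x, γ (σ i x) = τ i (γ x)) (π : Measure G) [IsProbabilityMeasure π]
  (herg : ∀ (g : G →ᵇ ℝ) (y : G), Tendsto (fun t => flow (jumpGen r τ) t g y) atTop (𝓝 (mean π g)))

include hγ in
omit [MeasurableSpace G] [DiscreteMeasurableSpace G] in
theorem flow_pullback (t : ℝ) (g : G →ᵇ ℝ) :
    flow (jumpGen r σ) t (pullback γ g) = pullback γ (flow (jumpGen r τ) t g) :=
  flow_intertwine _ _ (pullback γ) (fun f => by ext x; simp [jumpGen_apply, hγ]) t g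

include hr herg

theorem tendsto_mean_abs_flow_sub (g : G →ᵇ ℝ) :
    Tendsto (fun t =>
      mean π |flow (jumpGen r τ) t g - BoundedContinuousFunction.const G (mean π g)|)
      atTop (𝓝 0) := by
  have h0 : Tendsto (fun t => ∫ y, |flow (jumpGen r τ) t g y - mean π g| ∂π) atTop
      (𝓝 (∫ _, (0 : ℝ) ∂π)) := by
    refine tendsto_integral_filter_of_dominated_convergence (fun _ => 2 * ‖g‖)
      (Eventually.of_forall fun t => Measurable.of_discrete.aestronglyMeasurable) ?_
      (integrable_const _) (Eventually.of_forall fun y => ?_)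
    · filter_upwards [eventually_ge_atTop 0] with t ht
      refine Eventually.of_forall fun y => ?_
      have h1 := (BoundedContinuousFunction.norm_coe_le_norm _ y).trans
        (norm_flow_jumpGen_apply_le hr τ ht g)
      rw [Real.norm_eq_abs] at h1
      rw [Real.norm_eq_abs, abs_abs]
      refine (abs_sub _ _).trans ?_
      linarith [abs_mean_le π g]
    · simpa using ((herg g y).sub_const (mean π g)).abs
  rwa [integral_zero] at h0

include hγ

/-- **Asymptotic decoupling**: for a function `f` that varies slowly along the jumps, and a bounded
function `g` of the ergodic component `γ x`, the expectation of `f * g` at a late time nearly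
factorizes. Over a bounded time before the observation `f` does not change much, whereas `g` is
averaged to its stationary mean. -/
theorem exists_decoupling (x₀ : S) (g : G →ᵇ ℝ) {ε : ℝ} (hε : 0 < ε) :
    ∃ C s₀ : ℝ, 0 ≤ C ∧ 0 ≤ s₀ ∧ ∀ (f : S →ᵇ ℝ), ‖f‖ ≤ 1 → ∀ δ, 0 ≤ δ →
      (∀ i x, |f (σ i x) - f x| ≤ δ) → ∀ s, s₀ ≤ s →
      |flow (jumpGen r σ) s (f * pullback γ g) x₀ - mean π g * flow (jumpGen r σ) s f x₀|
        ≤ ε + C * δ := by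
  set L := jumpGen r σ
  set m := mean π g
  have hR : 0 ≤ ∑ i, r i := Finset.sum_nonneg fun i _ => hr i
  -- The memory of `γ` is lost, up to `ε`, within time `p`.
  obtain ⟨p, hp0, hp⟩ : ∃ p, 0 ≤ p ∧ mean π |flow (jumpGen r τ) p g -
      BoundedContinuousFunction.const G m| < ε :=
    ((eventually_ge_atTop 0).and
      ((tendsto_mean_abs_flow_sub hr τ π herg g).eventually_lt_const hε)).exists
  set h := flow (jumpGen r τ) p g - BoundedContinuousFunction.const G m
  have hh : Tendsto (fun s => flow L s (pullback γ |h|) x₀) atTop (𝓝 (mean π |h|)) :=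
    (herg |h| (γ x₀)).congr fun s => by rw [flow_pullback σ τ γ hγ]; rfl
  obtain ⟨s₁, hs₁⟩ := eventually_atTop.1 (hh.eventually_lt_const hp)
  refine ⟨2 * (∑ i, r i) * p * ‖g‖, max s₁ 0 + p, by positivity, by positivity, ?_⟩
  intro f hf δ hδ hfδ s hs
  obtain ⟨a, rfl⟩ : ∃ a, s = a + p := ⟨s - p, by ring⟩
  have ha : max s₁ 0 ≤ a := by linarith
  have ha0 : 0 ≤ a := (le_max_right _ _).trans ha
  have hcomm : ‖flow L p * ContinuousLinearMap.mul ℝ (S →ᵇ ℝ) f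
      - ContinuousLinearMap.mul ℝ (S →ᵇ ℝ) f * flow L p‖ ≤ (∑ i, r i) * δ * p :=
    (norm_commutator_flow_le L _ (fun t ht => norm_flow_jumpGen_le hr σ ht) hp0).trans (by
      gcongr
      exact norm_commutator_jumpGen_mul_le hr σ f hδ hfδ)
  have hD : ∀ k : S →ᵇ ℝ, |flow L a (flow L p (f * k) - f * flow L p k) x₀|
      ≤ (∑ i, r i) * δ * p * ‖k‖ := fun k => by
    refine ((flow L a (flow L p (f * k) - f * flow L p k)).norm_coe_le_norm x₀).trans ?_
    refine (norm_flow_jumpGen_apply_le hr σ ha0 _).trans ?_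
    exact (flow L p * ContinuousLinearMap.mul ℝ (S →ᵇ ℝ) f
      - ContinuousLinearMap.mul ℝ (S →ᵇ ℝ) f * flow L p).le_of_opNorm_le hcomm k
  have hD1 := hD (pullback γ g)
  have hD2 := hD (BoundedContinuousFunction.const S 1)
  have hone : f * BoundedContinuousFunction.const S 1 = f := by ext x; simp
  have hsplit : flow L (a + p) (f * pullback γ g) x₀ - m * flow L (a + p) f x₀
      = flow L a (flow L p (f * pullback γ g) - f * flow L p (pullback γ g)) x₀
        + flow L a (f * pullback γ h) x₀
        - m * flow L a (flow L p (f * BoundedContinuousFunction.const S 1)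
          - f * flow L p (BoundedContinuousFunction.const S 1)) x₀ := by
    have h1 : f * flow L p (pullback γ g) = f * pullback γ h + m • f := by
      rw [flow_pullback σ τ γ hγ]
      ext x
      simp [h]
      ring
    rw [h1, flow_jumpGen_const, hone, flow_add_apply, flow_add_apply]
    simp only [map_sub, map_add, map_smul,
      BoundedContinuousFunction.coe_sub, BoundedContinuousFunction.coe_add,
      BoundedContinuousFunction.coe_smul, Pi.sub_apply, Pi.add_apply, smul_eq_mul]
    ring
  have hE : |flow L a (f * pullback γ h) x₀| ≤ ε := by
    refine (abs_flow_jumpGen_le hr σ ha0 (g := pullback γ |h|) (fun x => ?_) x₀).trans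
      (hs₁ a ((le_max_left _ _).trans ha)).le
    have := (f.norm_coe_le_norm x).trans hf
    rw [Real.norm_eq_abs] at this
    simpa [abs_mul] using mul_le_of_le_one_left (abs_nonneg (h (γ x))) this
  have hg : ‖pullback γ g‖ ≤ ‖g‖ := by
    simpa using (pullback γ).le_of_opNorm_le (norm_pullback_le γ) g
  have h1n : ‖BoundedContinuousFunction.const S (1 : ℝ)‖ ≤ 1 := by
    simpa using BoundedContinuousFunction.norm_const_le (α := S) (1 : ℝ)
  have hm : |m| ≤ ‖g‖ := abs_mean_le π g
  rw [hsplit]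
  calc _ ≤ (∑ i, r i) * δ * p * ‖pullback γ g‖ + ε
        + |m| * ((∑ i, r i) * δ * p * ‖BoundedContinuousFunction.const S (1 : ℝ)‖) := by
        refine (abs_sub _ _).trans (add_le_add ((abs_add_le _ _).trans (add_le_add hD1 hE)) ?_)
        rw [abs_mul]
        gcongr
    _ ≤ (∑ i, r i) * δ * p * ‖g‖ + ε + ‖g‖ * ((∑ i, r i) * δ * p * 1) := by gcongr
    _ = _ := by ring

end Additive

section Wave

variable {S : Type*} [TopologicalSpace S] [DiscreteTopology S]

/-- The bounded function `x ↦ cos (κ Y x + φ)`. -/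
noncomputable def wave (Y : S → ℝ) (κ φ : ℝ) : S →ᵇ ℝ :=
  BoundedContinuousFunction.ofNormedAddCommGroup (fun x => Real.cos (κ * Y x + φ))
    continuous_of_discreteTopology 1 fun _ => Real.abs_cos_le_one _

@[simp]
theorem wave_apply (Y : S → ℝ) (κ φ : ℝ) (x : S) : wave Y κ φ x = Real.cos (κ * Y x + φ) := rfl

theorem norm_wave_le (Y : S → ℝ) (κ φ : ℝ) : ‖wave Y κ φ‖ ≤ 1 :=
  (BoundedContinuousFunction.norm_le zero_le_one).2 fun _ => Real.abs_cos_le_one _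

theorem hasDerivAt_wave (Y : S → ℝ) (κ φ : ℝ) :
    HasDerivAt (wave Y κ) (wave Y κ (φ + Real.pi / 2)) φ := by
  have h : ∀ ψ, wave Y κ ψ
      = Real.cos ψ • wave Y κ 0 + Real.sin ψ • wave Y κ (Real.pi / 2) := fun ψ => by
    ext x
    simp [Real.cos_add]
    ring
  have h1 : HasDerivAt (fun ψ => Real.cos ψ • wave Y κ 0 + Real.sin ψ • wave Y κ (Real.pi / 2))
      (-Real.sin φ • wave Y κ 0 + Real.cos φ • wave Y κ (Real.pi / 2)) φ :=
    HasDerivAt.add ((Real.hasDerivAt_cos φ).smul_const (wave Y κ 0))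
      ((Real.hasDerivAt_sin φ).smul_const (wave Y κ (Real.pi / 2)))
  rw [funext h]
  simpa only [Real.cos_add_pi_div_two, Real.sin_add_pi_div_two] using h1

theorem abs_wave_sub_le (Y : S → ℝ) (κ φ : ℝ) {x y : S} (h : |Y y - Y x| ≤ 1) :
    |wave Y κ φ y - wave Y κ φ x| ≤ |κ| := by
  refine (Real.abs_cos_sub_cos_le _ _).trans ?_
  rw [show κ * Y y + φ - (κ * Y x + φ) = κ * (Y y - Y x) by ring, abs_mul]
  exact mul_le_of_le_one_right (abs_nonneg κ) h

end Wave

section AdditiveCLT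

variable {S G : Type*} [TopologicalSpace S] [DiscreteTopology S]
  [TopologicalSpace G] [DiscreteTopology G] [MeasurableSpace G] [DiscreteMeasurableSpace G]
  {ι : Type*} [Fintype ι] {r : ι → ℝ} (hr : ∀ i, 0 ≤ r i) (σ : ι → S → S) (τ : ι → G → G)
  (γ : S → G) (hγ : ∀ i x, γ (σ i x) = τ i (γ x)) (π : Measure G) [IsProbabilityMeasure π]
  (herg : ∀ (g : G →ᵇ ℝ) (y : G), Tendsto (fun t => flow (jumpGen r τ) t g y) atTop (𝓝 (mean π g)))
  {Y : S → ℝ} {v : ℝ} {q : G →ᵇ ℝ} (hY : ∀ i x, |Y (σ i x) - Y x| ≤ 1)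
  (hdrift : ∀ x, ∑ i, r i * (Y (σ i x) - Y x) = v)
  (hquad : ∀ x, ∑ i, r i * (Y (σ i x) - Y x) ^ 2 = q (γ x))

theorem hasDerivAt_flow_wave (κ φ : ℝ) (x : S) (t : ℝ) :
    HasDerivAt (fun t => flow (jumpGen r σ) t (wave Y κ (φ - κ * v * t)) x)
      (flow (jumpGen r σ) t (jumpGen r σ (wave Y κ (φ - κ * v * t))
        - (κ * v) • wave Y κ (φ - κ * v * t + Real.pi / 2)) x) t := by
  have h1 : HasDerivAt (fun t => wave Y κ (φ - κ * v * t))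
      (-(κ * v) • wave Y κ (φ - κ * v * t + Real.pi / 2)) t := by
    have h0 : HasDerivAt (fun t => φ - κ * v * t) (-(κ * v)) t :=
      (((hasDerivAt_id t).const_mul (κ * v)).const_sub φ).congr_deriv (by ring)
    exact HasDerivAt.scomp t (hasDerivAt_wave Y κ (φ - κ * v * t)) h0
  have h2 := (hasDerivAt_flow (jumpGen r σ) t).clm_apply h1
  have h3 := (BoundedContinuousFunction.evalCLM ℝ x).hasFDerivAt.comp_hasDerivAt t h2
  refine h3.congr_deriv ?_
  simp [sub_eq_add_neg]

include hr hY hdrift hquad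

omit [DiscreteTopology G] [MeasurableSpace G] [DiscreteMeasurableSpace G] in
/-- Second order expansion of the generator on a wave travelling with the drift: the first order
term cancels, since `Y - v t` is a martingale. -/
theorem norm_jumpGen_wave_le {κ : ℝ} (hκ : |κ| ≤ 1) (ψ : ℝ) :
    ‖jumpGen r σ (wave Y κ ψ) - (κ * v) • wave Y κ (ψ + Real.pi / 2)
      + (κ ^ 2 / 2) • (wave Y κ ψ * pullback γ q)‖ ≤ (∑ i, r i) * |κ| ^ 3 := by
  have hR : 0 ≤ ∑ i, r i := Finset.sum_nonneg fun i _ => hr i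
  rw [BoundedContinuousFunction.norm_le (by positivity)]
  intro x
  have h : (jumpGen r σ (wave Y κ ψ) - (κ * v) • wave Y κ (ψ + Real.pi / 2)
      + (κ ^ 2 / 2) • (wave Y κ ψ * pullback γ q)) x
      = ∑ i, r i * (Real.cos (κ * Y x + ψ + κ * (Y (σ i x) - Y x)) - Real.cos (κ * Y x + ψ)
        + κ * (Y (σ i x) - Y x) * Real.sin (κ * Y x + ψ)
        + (κ * (Y (σ i x) - Y x)) ^ 2 / 2 * Real.cos (κ * Y x + ψ)) := by
    simp only [BoundedContinuousFunction.coe_add, BoundedContinuousFunction.coe_sub,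
      BoundedContinuousFunction.coe_smul, BoundedContinuousFunction.coe_mul, Pi.add_apply,
      Pi.sub_apply, Pi.mul_apply, smul_eq_mul, jumpGen_apply, wave_apply, pullback_apply,
      ← hquad x, ← hdrift x, ← add_assoc, Real.cos_add_pi_div_two, Finset.mul_sum, Finset.sum_mul,
      ← Finset.sum_sub_distrib, ← Finset.sum_add_distrib]
    refine Finset.sum_congr rfl fun i _ => ?_
    rw [show κ * Y x + ψ + κ * (Y (σ i x) - Y x) = κ * Y (σ i x) + ψ by ring]
    ring
  rw [h, Finset.sum_mul]
  refine (norm_sum_le _ _).trans (Finset.sum_le_sum fun i _ => ?_)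
  rw [norm_mul, Real.norm_of_nonneg (hr i)]
  have h1 : |κ * (Y (σ i x) - Y x)| ≤ |κ| := by
    rw [abs_mul]
    exact mul_le_of_le_one_right (abs_nonneg _) (hY i x)
  have := hr i
  gcongr
  exact (abs_cos_add_sub_le (h1.trans hκ)).trans (by gcongr)

include hγ herg

/-- **Central limit theorem** for the real characteristic functions of an additive functional `Y`
with constant drift `v`, bounded jumps, and squared jump rate `q ∘ γ` driven by an ergodic
component `γ`. By asymptotic decoupling `q ∘ γ` may be replaced by its stationary mean, and the
expectation of `cos (κ (Y - v t) + φ)` solves `u' = - (κ² / 2) (mean π q) u` up to `o(κ²)`. -/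
theorem tendsto_flow_wave (x₀ : S) (θ φ : ℝ) :
    Tendsto (fun t => flow (jumpGen r σ) t (wave Y (θ / √t) (φ - θ / √t * v * t)) x₀) atTop
      (𝓝 (Real.exp (-(θ ^ 2 / 2 * mean π q)) * Real.cos φ)) := by
  set L := jumpGen r σ
  set R := ∑ i, r i
  have hR : 0 ≤ R := Finset.sum_nonneg fun i _ => hr i
  have hm : 0 ≤ mean π q := by
    refine ge_of_tendsto (herg q (γ x₀)) ?_
    filter_upwards [eventually_ge_atTop 0] with t ht
    rw [← pullback_apply γ, ← flow_pullback σ τ γ hγ]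
    refine flow_jumpGen_nonneg hr σ ht (fun x => ?_) x₀
    rw [pullback_apply, ← hquad x]
    exact Finset.sum_nonneg fun i _ => mul_nonneg (hr i) (sq_nonneg _)
  have hκ : Tendsto (fun t : ℝ => θ / √t) atTop (𝓝 0) :=
    Tendsto.const_div_atTop Real.tendsto_sqrt_atTop θ
  have hκ' : Tendsto (fun t : ℝ => |θ / √t|) atTop (𝓝 0) := by simpa using hκ.abs
  have hinit : Tendsto (fun t : ℝ => Real.exp (-(θ ^ 2 / 2 * mean π q)) *
      Real.cos (θ / √t * Y x₀ + φ)) atTop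
      (𝓝 (Real.exp (-(θ ^ 2 / 2 * mean π q)) * Real.cos φ)) := by
    refine Tendsto.const_mul _ ((Real.continuous_cos.tendsto φ).comp ?_)
    simpa using (hκ.mul_const (Y x₀)).add_const φ
  suffices h : Tendsto (fun t => flow L t (wave Y (θ / √t) (φ - θ / √t * v * t)) x₀
      - Real.exp (-(θ ^ 2 / 2 * mean π q)) * Real.cos (θ / √t * Y x₀ + φ)) atTop (𝓝 0) by
    simpa using h.add hinit
  rw [Metric.tendsto_atTop']
  intro ε hε
  obtain ⟨C, s₀, hC, hs₀, hdec⟩ := exists_decoupling hr σ τ γ hγ π herg x₀ q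
    (ε := ε / (θ ^ 2 + 1)) (by positivity)
  -- Error terms: the time interval `[0, s₀]`, the Taylor remainder, and the decoupling.
  have hbound : Tendsto (fun t : ℝ => |θ / √t| ^ 2 * ((R + ‖q‖) * s₀) + θ ^ 2 * R * |θ / √t|
      + θ ^ 2 / 2 * (ε / (θ ^ 2 + 1) + C * |θ / √t|)) atTop
      (𝓝 (θ ^ 2 / 2 * (ε / (θ ^ 2 + 1)))) := by
    have := (((hκ'.pow 2).mul_const ((R + ‖q‖) * s₀)).add (hκ'.const_mul (θ ^ 2 * R))).add
      (((hκ'.const_mul C).const_add (ε / (θ ^ 2 + 1))).const_mul (θ ^ 2 / 2))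
    simpa using this
  have hlt : θ ^ 2 / 2 * (ε / (θ ^ 2 + 1)) < ε := by
    rw [mul_div_assoc', div_lt_iff₀ (by positivity)]
    nlinarith [sq_nonneg θ]
  obtain ⟨t₀, ht₀⟩ := eventually_atTop.1 ((hbound.eventually_lt_const hlt).and
    ((hκ'.eventually_lt_const zero_lt_one).and (eventually_gt_atTop s₀)))
  refine ⟨t₀, fun t ht => ?_⟩
  obtain ⟨h1, h2, h3⟩ := ht₀ t ht.le
  refine lt_of_le_of_lt ?_ h1
  set κ := θ / √t
  have ht0 : 0 < t := hs₀.trans_lt h3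
  have hκt : κ ^ 2 * t = θ ^ 2 := by
    rw [div_pow, Real.sq_sqrt ht0.le, div_mul_cancel₀ _ ht0.ne']
  set c := κ ^ 2 / 2 * mean π q
  have hc : 0 ≤ c := by positivity
  set f : ℝ → S →ᵇ ℝ := fun s => wave Y κ (φ - κ * v * s)
  set u : ℝ → ℝ := fun s => flow L s (f s) x₀
  set u' : ℝ → ℝ := fun s => flow L s (L (f s)
    - (κ * v) • wave Y κ (φ - κ * v * s + Real.pi / 2)) x₀
  have hu : ∀ s, HasDerivAt u (u' s) s := fun s => hasDerivAt_flow_wave σ κ φ x₀ s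
  have hode : ∀ s, 0 ≤ s → |u' s + c * u s| ≤ R * |κ| ^ 3
      + κ ^ 2 / 2 * |flow L s (f s * pullback γ q) x₀ - mean π q * flow L s (f s) x₀| :=
    fun s hs => by
    have heq : u' s + c * u s = flow L s (L (f s) - (κ * v) •
        wave Y κ (φ - κ * v * s + Real.pi / 2) + (κ ^ 2 / 2) • (f s * pullback γ q)) x₀
        - κ ^ 2 / 2 * (flow L s (f s * pullback γ q) x₀ - mean π q * flow L s (f s) x₀) := by
      simp only [u', u, c, map_add, map_smul, BoundedContinuousFunction.coe_add,
        BoundedContinuousFunction.coe_smul, Pi.add_apply, smul_eq_mul]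
      ring
    rw [heq]
    refine (abs_sub _ _).trans (add_le_add ?_ ?_)
    · refine ((flow L s _).norm_coe_le_norm x₀).trans ?_
      exact (norm_flow_jumpGen_apply_le hr σ hs _).trans
        (norm_jumpGen_wave_le hr σ γ hY hdrift hquad h2.le _)
    · rw [abs_mul, abs_of_nonneg (by positivity)]
  have hlate := abs_sub_exp_mul_le (δ := R * |κ| ^ 3 + κ ^ 2 / 2 *
    (ε / (θ ^ 2 + 1) + C * |κ|)) hc h3.le hu fun s hs => by
      refine (hode s (hs₀.trans hs.1)).trans ?_
      gcongr
      exact hdec (f s) (norm_wave_le _ _ _) |κ| (abs_nonneg κ)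
        (fun i x => abs_wave_sub_le Y κ _ (hY i x)) s hs.1
  have hearly := abs_sub_exp_mul_le (δ := κ ^ 2 * (R + ‖q‖)) hc hs₀ hu fun s hs => by
      refine (hode s hs.1).trans ?_
      have hκ3 : |κ| ^ 3 ≤ κ ^ 2 := by
        rw [← sq_abs κ]
        exact pow_le_pow_of_le_one (abs_nonneg κ) h2.le (by norm_num)
      have hf : ∀ k : S →ᵇ ℝ, |flow L s k x₀| ≤ ‖k‖ := fun k =>
        ((flow L s k).norm_coe_le_norm x₀).trans (norm_flow_jumpGen_apply_le hr σ hs.1 k)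
      have hq : ‖pullback γ q‖ ≤ ‖q‖ := by
        simpa using (pullback γ).le_of_opNorm_le (norm_pullback_le γ) q
      have h4 : |flow L s (f s * pullback γ q) x₀| ≤ 1 * ‖q‖ :=
        (hf _).trans ((norm_mul_le _ _).trans (by gcongr; exact norm_wave_le _ _ _))
      have h5 : |mean π q * flow L s (f s) x₀| ≤ ‖q‖ * 1 := by
        rw [abs_mul]
        gcongr
        · exact abs_mean_le π q
        · exact (hf _).trans (norm_wave_le _ _ _)
      have h6 := (abs_sub (flow L s (f s * pullback γ q) x₀) (mean π q * flow L s (f s) x₀)).trans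
        (add_le_add h4 h5)
      calc _ ≤ R * κ ^ 2 + κ ^ 2 / 2 * (1 * ‖q‖ + ‖q‖ * 1) := by gcongr
        _ = _ := by ring
  have hct : c * t = θ ^ 2 / 2 * mean π q := by
    rw [← hκt]; ring
  have hu0 : u 0 = Real.cos (κ * Y x₀ + φ) := by simp [u, f, flow_zero]
  rw [Real.dist_eq, sub_zero, ← hct, ← hu0]
  have hsplit : u t - Real.exp (-(c * t)) * u 0
      = (u t - Real.exp (-(c * (t - s₀))) * u s₀)
        + Real.exp (-(c * (t - s₀))) * (u s₀ - Real.exp (-(c * (s₀ - 0))) * u 0) := by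
    have : Real.exp (-(c * t)) = Real.exp (-(c * (t - s₀))) * Real.exp (-(c * (s₀ - 0))) := by
      rw [← Real.exp_add]; ring_nf
    rw [this]
    ring
  calc |u t - Real.exp (-(c * t)) * u 0|
      ≤ (R * |κ| ^ 3 + κ ^ 2 / 2 * (ε / (θ ^ 2 + 1) + C * |κ|)) * (t - s₀)
        + 1 * (κ ^ 2 * (R + ‖q‖) * (s₀ - 0)) := by
        rw [hsplit]
        refine (abs_add_le _ _).trans (add_le_add hlate ?_)
        rw [abs_mul, abs_of_pos (Real.exp_pos _)]
        gcongr
        rw [Real.exp_le_one_iff]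
        have := mul_nonneg hc (sub_nonneg.2 h3.le)
        linarith
    _ ≤ (R * |κ| ^ 3 + κ ^ 2 / 2 * (ε / (θ ^ 2 + 1) + C * |κ|)) * t
        + 1 * (κ ^ 2 * (R + ‖q‖) * (s₀ - 0)) := by
        gcongr
        linarith
    _ = |κ| ^ 2 * ((R + ‖q‖) * s₀) + κ ^ 2 * t * R * |κ|
        + κ ^ 2 * t / 2 * (ε / (θ ^ 2 + 1) + C * |κ|) := by
        rw [← sq_abs κ]; ring
    _ = _ := by rw [hκt]

/-- The central limit theorem holds jointly with, and asymptotically independently of, the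
convergence of the ergodic component. -/
theorem tendsto_flow_wave_mul (x₀ : S) (g : G →ᵇ ℝ) (θ φ : ℝ) :
    Tendsto (fun t => flow (jumpGen r σ) t
      (wave Y (θ / √t) (φ - θ / √t * v * t) * pullback γ g) x₀) atTop
      (𝓝 (mean π g * (Real.exp (-(θ ^ 2 / 2 * mean π q)) * Real.cos φ))) := by
  have h := (tendsto_flow_wave hr σ τ γ hγ π herg hY hdrift hquad x₀ θ φ).const_mul (mean π g)
  have hκ : Tendsto (fun t : ℝ => |θ / √t|) atTop (𝓝 0) := by
    simpa using (Tendsto.const_div_atTop Real.tendsto_sqrt_atTop θ).abs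
  have hdiff : Tendsto (fun t => flow (jumpGen r σ) t
      (wave Y (θ / √t) (φ - θ / √t * v * t) * pullback γ g) x₀
      - mean π g * flow (jumpGen r σ) t (wave Y (θ / √t) (φ - θ / √t * v * t)) x₀)
      atTop (𝓝 0) := by
    rw [Metric.tendsto_atTop']
    intro ε hε
    obtain ⟨C, s₀, hC, -, hdec⟩ := exists_decoupling hr σ τ γ hγ π herg x₀ g (half_pos hε)
    have hlim : Tendsto (fun t : ℝ => ε / 2 + C * |θ / √t|) atTop (𝓝 (ε / 2)) := by
      simpa using (hκ.const_mul C).const_add (ε / 2)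
    obtain ⟨t₀, ht₀⟩ := eventually_atTop.1
      ((hlim.eventually_lt_const (half_lt_self hε)).and (eventually_ge_atTop s₀))
    refine ⟨t₀, fun t ht => ?_⟩
    rw [Real.dist_eq, sub_zero]
    exact (hdec _ (norm_wave_le _ _ _) _ (abs_nonneg _)
      (fun i x => abs_wave_sub_le Y _ _ (hY i x)) t (ht₀ t ht.le).2).trans_lt (ht₀ t ht.le).1
  simpa using hdiff.add h

end AdditiveCLT

/-! ### The gap process -/

section Network

variable {N : ℕ}

/-- The vector of gaps with a single empty site, in the gap between the particles `k - 1` and `k`.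
For `k = 0` and `k = N + 1` (the unbounded regions to the left and to the right of all particles) it
is zero. -/
def gapUnit (k : ℕ) : Fin N → ℕ := fun j => if (j : ℕ) + 1 = k then 1 else 0

theorem gapUnit_zero : gapUnit (N := N) 0 = 0 := by
  ext j
  simp [gapUnit]

theorem gapUnit_last : gapUnit (N := N) (N + 1) = 0 := by
  ext j
  simp [gapUnit, j.2.ne]

instance (k : ℕ) (η : Fin N → ℕ) : Decidable (gapUnit k ≤ η) :=
  inferInstanceAs (Decidable (∀ j, gapUnit k j ≤ η j))

/-- The effect on the gaps of a particle jumping from one side to the other: an empty site is moved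
from gap `k` to gap `l`, if there is one. -/
def gapMove (k l : ℕ) (η : Fin N → ℕ) : Fin N → ℕ :=
  if gapUnit k ≤ η then η - gapUnit k + gapUnit l else η

/-- The effect on the gaps of the attempted jumps: `Sum.inl i` is a jump of particle `i` to the
left, `Sum.inr i` to the right. -/
def gapJump : Fin (N + 1) ⊕ Fin (N + 1) → (Fin N → ℕ) → (Fin N → ℕ) :=
  Sum.elim (fun i => gapMove i (i + 1)) (fun i => gapMove (i + 1) i)

theorem eqvGen_gapJump {a b : Fin (N + 1) → ℝ} (hb : ∀ i, 0 < b i) (η ξ : Fin N → ℕ) :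
    Relation.EqvGen (fun x y => ∃ i, 0 < Sum.elim a b i ∧ y = gapJump i x) η ξ := by
  set E := fun x y : Fin N → ℕ => ∃ i, 0 < Sum.elim a b i ∧ y = gapJump i x
  -- Jumps to the right carry an empty site from gap `k + 1` to gap `k`, and finally to the left of
  -- all particles.
  have h1 : ∀ k, k ≤ N + 1 → ∀ η, Relation.EqvGen E (η + gapUnit k) η := by
    intro k
    induction k with
    | zero => intro _ η; rw [gapUnit_zero, add_zero]; exact .refl _
    | succ k ih =>
      intro hk η
      refine .trans _ (η + gapUnit k) _ (.rel _ _ ⟨Sum.inr ⟨k, hk⟩, hb _, ?_⟩) (ih (by omega) η)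
      have : gapUnit (k + 1) ≤ η + gapUnit (k + 1) := le_add_self
      simp [gapJump, gapMove, this]
  have h2 : ∀ n, ∀ η : Fin N → ℕ, ∑ j, η j = n → Relation.EqvGen E η 0 := by
    intro n
    induction n with
    | zero =>
      intro η hη
      have : η = 0 := by
        ext j
        exact (Finset.sum_eq_zero_iff.1 hη) j (Finset.mem_univ j)
      rw [this]
      exact .refl _
    | succ n ih =>
      intro η hη
      obtain ⟨j, -, hj⟩ : ∃ j ∈ Finset.univ, η j ≠ 0 := by
        by_contra! h
        rw [Finset.sum_eq_zero h] at hη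
        omega
      have hle : gapUnit ((j : ℕ) + 1) ≤ η := by
        intro l
        simp only [gapUnit, add_left_inj, Fin.val_inj]
        split_ifs with h
        · subst h; omega
        · omega
      have hsum : ∑ l, gapUnit (N := N) ((j : ℕ) + 1) l = 1 := by
        simp [gapUnit, Fin.val_inj]
      have hdecomp := tsub_add_cancel_of_le hle
      rw [← hdecomp]
      refine .trans _ _ _ (h1 _ (by omega) _) (ih _ ?_)
      rw [← hdecomp] at hη
      simp only [Pi.add_apply, Finset.sum_add_distrib, hsum] at hη
      omega
  exact .trans _ 0 _ (h2 _ η rfl) (.symm _ _ (h2 _ ξ rfl))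

/-- The product of geometric distributions with weights `(1 - ρ j) * ρ j ^ z`. -/
theorem exists_geometric_product (ρ : Fin N → ℝ) (h0 : ∀ j, 0 < ρ j) (h1 : ∀ j, ρ j < 1) :
    ∃ π : Measure (Fin N → ℕ), IsProbabilityMeasure π ∧
      ∀ z, π.real {z} = ∏ j, ρ j ^ z j * (1 - ρ j) := by
  let p : Fin N → unitInterval := fun j => ⟨1 - ρ j, by linarith [h1 j], by linarith [h0 j]⟩
  have hp : ∀ j, p j ≠ 0 := fun j h => by
    have := congrArg Subtype.val h
    simp only [p, Set.Icc.coe_zero] at this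
    linarith [h1 j]
  refine ⟨Measure.pi fun j => geometricMeasure (p j), inferInstance, fun z => ?_⟩
  rw [measureReal_def, Measure.pi_singleton, ENNReal.toReal_prod]
  refine Finset.prod_congr rfl fun j _ => ?_
  rw [← measureReal_def, geometricMeasure_real_singleton (hp j)]
  simp [p]

section Stationary

variable {ρ : ℕ → ℝ} {π : Measure (Fin N → ℕ)} [IsProbabilityMeasure π]
  (hρ0 : ρ 0 = 1) (hρN : ρ (N + 1) = 1)
  (hπ : ∀ z, π.real {z} = ∏ j : Fin N, ρ (j + 1) ^ z j * (1 - ρ (j + 1)))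
include hρ0 hρN hπ

omit [IsProbabilityMeasure π] in
theorem real_singleton_add_gapUnit {k : ℕ} (hk : k ≤ N + 1) (z : Fin N → ℕ) :
    π.real {z + gapUnit k} = ρ k * π.real {z} := by
  rcases Nat.eq_zero_or_pos k with rfl | hk0
  · rw [gapUnit_zero, hρ0, add_zero, one_mul]
  rcases hk.eq_or_lt with rfl | hkN
  · rw [gapUnit_last, hρN, add_zero, one_mul]
  have h : ∏ j : Fin N, ρ (j + 1) ^ gapUnit (N := N) k j = ρ k := by
    rw [Finset.prod_eq_single (⟨k - 1, by omega⟩ : Fin N)]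
    · simp [gapUnit, Nat.sub_add_cancel hk0]
    · intro j _ hj
      have : (j : ℕ) + 1 ≠ k := fun e => hj (Fin.ext (by simp; omega))
      simp [gapUnit, this]
    · simp
  rw [hπ, hπ, ← h, ← Finset.prod_mul_distrib]
  refine Finset.prod_congr rfl fun j _ => ?_
  rw [Pi.add_apply, pow_add]
  ring

/-- Removing an empty site from gap `k`, under the product of geometric distributions, amounts to
multiplying by the weight `ρ k`. -/
theorem integral_sub_gapUnit {k : ℕ} (hk : k ≤ N + 1) (G : (Fin N → ℕ) →ᵇ ℝ) :
    ∫ η, (if gapUnit k ≤ η then G (η - gapUnit k) else 0) ∂π = ρ k * mean π G := by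
  have hint : Integrable (fun η : Fin N → ℕ => if gapUnit k ≤ η then G (η - gapUnit k) else 0) π :=
    Integrable.of_bound Measurable.of_discrete.aestronglyMeasurable ‖G‖
      (Eventually.of_forall fun η => by
        split_ifs
        · exact G.norm_coe_le_norm _
        · simp)
  rw [mean_apply, integral_countable hint, integral_countable (G.integrable π), ← tsum_mul_left,
    ← Function.Injective.tsum_eq (add_left_injective (gapUnit k))]
  · refine tsum_congr fun z => ?_
    have : gapUnit k ≤ z + gapUnit k := le_add_self
    simp only [this, if_true, add_tsub_cancel_right, smul_eq_mul]
    rw [real_singleton_add_gapUnit hρ0 hρN hπ hk, mul_assoc]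
  · intro η hη
    refine ⟨η - gapUnit k, tsub_add_cancel_of_le ?_⟩
    by_contra h
    simp [h] at hη

theorem integral_gapMove_sub {k l : ℕ} (hk : k ≤ N + 1) (g : (Fin N → ℕ) →ᵇ ℝ) :
    ∫ η, (g (gapMove k l η) - g η) ∂π
      = ρ k * (mean π (pullback (· + gapUnit l) g) - mean π (pullback (· + gapUnit k) g)) := by
  rw [← map_sub, ← integral_sub_gapUnit hρ0 hρN hπ hk]
  refine integral_congr_ae (Eventually.of_forall fun η => ?_)
  dsimp only
  split_ifs with h
  · simp [gapMove, h, tsub_add_cancel_of_le h]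
  · simp [gapMove, h]

/-- The **product form** of the stationary distribution of the gap process, under the traffic
equations `b i * ρ (i + 1) - a i * ρ i = v`: the contributions of the particles telescope. -/
theorem mean_jumpGen_gapJump {a b : Fin (N + 1) → ℝ} {v : ℝ}
    (hflow : ∀ i : Fin (N + 1), b i * ρ (i + 1) - a i * ρ i = v) (g : (Fin N → ℕ) →ᵇ ℝ) :
    mean π (jumpGen (Sum.elim a b) gapJump g) = 0 := by
  set G : ℕ → ℝ := fun k => mean π (pullback (· + gapUnit k) g)
  have hint : ∀ φ : (Fin N → ℕ) → (Fin N → ℕ), Integrable (fun η => g (φ η) - g η) π := fun φ =>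
    (pullback φ g - g).integrable π
  rw [mean_apply]
  simp_rw [jumpGen_apply]
  rw [integral_finsetSum _ fun i _ => (hint _).const_mul _, Fintype.sum_sum_type]
  simp only [integral_const_mul, gapJump, Sum.elim_inl, Sum.elim_inr]
  rw [← Finset.sum_add_distrib]
  have h : ∀ i : Fin (N + 1), a i * ∫ η, (g (gapMove i (i + 1) η) - g η) ∂π
      + b i * ∫ η, (g (gapMove (i + 1) i η) - g η) ∂π = v * (G i - G (i + 1)) := fun i => by
    rw [integral_gapMove_sub hρ0 hρN hπ (by omega), integral_gapMove_sub hρ0 hρN hπ (by omega),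
      ← hflow i]
    simp only [G]
    ring
  rw [Finset.sum_congr rfl fun i _ => h i, ← Finset.mul_sum,
    Fin.sum_univ_eq_sum_range (fun k => G k - G (k + 1)), Finset.sum_range_sub']
  simp [G, gapUnit_zero, gapUnit_last]

end Stationary

/-! ### Configurations and their gaps -/

/-- The vector of gaps of a configuration. -/
def gapVec (x : Config N) (i : Fin N) : ℕ := (gap x i).toNat

theorem gap_nonneg (x : Config N) (i : Fin N) : 0 ≤ gap x i := by
  have := x.2 (Fin.castSucc_lt_succ (i := i))
  unfold gap
  omega

theorem coe_gapVec (x : Config N) (i : Fin N) : (gapVec x i : ℤ) = gap x i :=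
  Int.toNat_of_nonneg (gap_nonneg x i)

theorem exists_right_iff (x : Config N) (i : Fin (N + 1)) :
    (∃ j, x.1 j = x.1 i + 1) ↔ ¬ gapUnit (i + 1) ≤ gapVec x := by
  rw [Pi.le_def]
  push Not
  constructor
  · rintro ⟨j, hj⟩
    have hij : i < j := x.2.lt_iff_lt.1 (by omega)
    obtain ⟨l, rfl⟩ : ∃ l : Fin N, l.castSucc = i := ⟨⟨i, by omega⟩, rfl⟩
    have h1 := x.2.monotone (show l.succ ≤ j from hij)
    refine ⟨l, ?_⟩
    zify
    rw [coe_gapVec, gap]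
    simp [gapUnit]
    omega
  · rintro ⟨l, hl⟩
    have h1 : l.castSucc = i := by
      by_contra h
      have : (l : ℕ) ≠ i := fun e => h (Fin.ext e)
      simp [gapUnit, this] at hl
    subst h1
    zify at hl
    rw [coe_gapVec] at hl
    have := gap_nonneg x l
    simp [gapUnit] at hl
    unfold gap at hl this
    exact ⟨l.succ, by omega⟩

theorem exists_left_iff (x : Config N) (i : Fin (N + 1)) :
    (∃ j, x.1 j = x.1 i - 1) ↔ ¬ gapUnit i ≤ gapVec x := by
  rw [Pi.le_def]
  push Not
  constructor
  · rintro ⟨j, hj⟩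
    have hij : j < i := x.2.lt_iff_lt.1 (by omega)
    obtain ⟨l, rfl⟩ : ∃ l : Fin N, l.succ = i :=
      ⟨⟨i - 1, by omega⟩, Fin.ext (by simp; omega)⟩
    have h1 := x.2.monotone (show j ≤ l.castSucc from Fin.le_castSucc_iff.2 hij)
    refine ⟨l, ?_⟩
    zify
    rw [coe_gapVec, gap]
    simp [gapUnit]
    omega
  · rintro ⟨l, hl⟩
    have h1 : l.succ = i := by
      by_contra h
      have : (l : ℕ) + 1 ≠ i := fun e => h (Fin.ext e)
      simp [gapUnit, this] at hl
    subst h1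
    zify at hl
    rw [coe_gapVec] at hl
    have := gap_nonneg x l
    simp [gapUnit] at hl
    unfold gap at hl this
    exact ⟨l.castSucc, by omega⟩

/-- The target site of particle `i` is empty if and only if the gap on that side has an empty site,
which always holds in the unbounded regions. -/
theorem stepRight_apply (x : Config N) (i j : Fin (N + 1)) :
    (stepRight i x).1 j
      = x.1 j + if gapUnit (i + 1) ≤ gapVec x then (if j = i then 1 else 0) else 0 := by
  unfold stepRight
  by_cases h : ∃ j, x.1 j = x.1 i + 1
  · rw [dif_pos h, if_neg ((exists_right_iff x i).1 h), add_zero]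
  · rw [dif_neg h, if_pos (not_not.1 (mt (exists_right_iff x i).2 h))]
    by_cases hj : j = i
    · subst hj; simp
    · simp [hj]

theorem stepLeft_apply (x : Config N) (i j : Fin (N + 1)) :
    (stepLeft i x).1 j
      = x.1 j - if gapUnit i ≤ gapVec x then (if j = i then 1 else 0) else 0 := by
  unfold stepLeft
  by_cases h : ∃ j, x.1 j = x.1 i - 1
  · rw [dif_pos h, if_neg ((exists_left_iff x i).1 h), sub_zero]
  · rw [dif_neg h, if_pos (not_not.1 (mt (exists_left_iff x i).2 h))]
    by_cases hj : j = i
    · subst hj; simp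
    · simp [hj]

theorem gapVec_stepRight (x : Config N) (i : Fin (N + 1)) :
    gapVec (stepRight i x) = gapMove (i + 1) i (gapVec x) := by
  ext j
  have h1 := coe_gapVec x j
  have h2 := coe_gapVec (stepRight i x) j
  rw [gap] at h1 h2
  rw [stepRight_apply, stepRight_apply] at h2
  unfold gapMove
  by_cases h : gapUnit (i + 1) ≤ gapVec x
  · have h3 := h j
    simp only [h, if_true, Pi.add_apply, Pi.sub_apply, Fin.ext_iff, Fin.val_succ,
      Fin.val_castSucc] at h2 ⊢
    simp only [gapUnit] at h3 ⊢
    split_ifs at h2 h3 ⊢ <;> omega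
  · simp only [h, if_false] at h2 ⊢
    omega

theorem gapVec_stepLeft (x : Config N) (i : Fin (N + 1)) :
    gapVec (stepLeft i x) = gapMove i (i + 1) (gapVec x) := by
  ext j
  have h1 := coe_gapVec x j
  have h2 := coe_gapVec (stepLeft i x) j
  rw [gap] at h1 h2
  rw [stepLeft_apply, stepLeft_apply] at h2
  unfold gapMove
  by_cases h : gapUnit i ≤ gapVec x
  · have h3 := h j
    simp only [h, if_true, Pi.add_apply, Pi.sub_apply, Fin.ext_iff, Fin.val_succ,
      Fin.val_castSucc] at h2 ⊢
    simp only [gapUnit] at h3 ⊢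
    split_ifs at h2 h3 ⊢ <;> omega
  · simp only [h, if_false] at h2 ⊢
    omega

/-- The attempted jumps of the exclusion process: `Sum.inl i` is a jump of particle `i` to the left,
`Sum.inr i` to the right. -/
noncomputable def configJump : Fin (N + 1) ⊕ Fin (N + 1) → Config N → Config N :=
  Sum.elim stepLeft stepRight

theorem gapVec_configJump (i : Fin (N + 1) ⊕ Fin (N + 1)) (x : Config N) :
    gapVec (configJump i x) = gapJump i (gapVec x) := by
  rcases i with i | i
  · exact gapVec_stepLeft x i
  · exact gapVec_stepRight x i

theorem generator_eq_jumpGen (a b : Fin (N + 1) → ℝ) :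
    generator a b = jumpGen (Sum.elim a b) configJump := by
  ext f x
  simp [generator_apply, jumpGen_apply, configJump, Finset.sum_add_distrib]

end Network

/-! ### The traffic equations -/

section Traffic

variable {N : ℕ} (a b : Fin (N + 1) → ℝ)

theorem alphaCoeff_zero : alphaCoeff a b 0 = a 0 / b 0 := by
  have : Finset.Iic (0 : Fin (N + 1)) = {0} := by ext; simp
  simp [alphaCoeff, this]

theorem betaCoeff_zero : betaCoeff a b 0 = 1 / b 0 := by
  have : Finset.Iic (0 : Fin (N + 1)) = {0} := by ext; simp
  simp [betaCoeff, this]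

theorem Iic_succ_eq_insert (i : Fin N) :
    Finset.Iic i.succ = insert i.succ (Finset.Iic i.castSucc) := by
  ext k
  simp [Fin.le_def, Fin.ext_iff]
  omega

theorem alphaCoeff_succ (i : Fin N) :
    alphaCoeff a b i.succ = a i.succ / b i.succ * alphaCoeff a b i.castSucc := by
  have h : i.succ ∉ Finset.Iic i.castSucc := by simp [Fin.le_def]
  rw [alphaCoeff, Iic_succ_eq_insert, Finset.prod_insert h, Finset.prod_insert h, alphaCoeff]
  exact mul_div_mul_comm _ _ _ _

theorem betaCoeff_succ (i : Fin N) :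
    betaCoeff a b i.succ = 1 / b i.succ + a i.succ / b i.succ * betaCoeff a b i.castSucc := by
  have h : i.succ ∉ Finset.Iic i.castSucc := by simp [Fin.le_def]
  rw [betaCoeff, Iic_succ_eq_insert, Finset.sum_insert h, betaCoeff, Finset.mul_sum]
  congr 1
  · simp
  · refine Finset.sum_congr rfl fun j hj => ?_
    rw [Finset.mem_Iic, Fin.le_def, Fin.val_castSucc] at hj
    have h1 : Finset.Ioc j i.succ = insert i.succ (Finset.Ioc j i.castSucc) := by
      ext k
      simp only [Finset.mem_Ioc, Finset.mem_insert, Fin.lt_def, Fin.le_def, Fin.ext_iff,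
        Fin.val_succ, Fin.val_castSucc]
      omega
    have h2 : Finset.Icc j i.succ = insert i.succ (Finset.Icc j i.castSucc) := by
      ext k
      simp only [Finset.mem_Icc, Finset.mem_insert, Fin.le_def, Fin.ext_iff, Fin.val_succ,
        Fin.val_castSucc]
      omega
    rw [h1, h2, Finset.prod_insert (by simp [Fin.le_def]),
      Finset.prod_insert (by simp [Fin.le_def])]
    exact mul_div_mul_comm _ _ _ _

/-- The loads of the gaps, including the two unbounded regions `k = 0` and `k = N + 1`, which are
never blocked and have load `1`; the gap to the right of particle `i` has the number `i + 1`. -/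
noncomputable def extLoad : ℕ → ℝ
  | 0 => 1
  | k + 1 => if h : k < N then load a b ⟨k, h⟩ else 1

theorem extLoad_zero : extLoad a b 0 = 1 := rfl

theorem extLoad_last : extLoad a b (N + 1) = 1 := by simp [extLoad]

theorem extLoad_succ (j : Fin N) : extLoad a b (j + 1) = load a b j := by simp [extLoad]

variable {a b} (ha : ∀ i, 0 ≤ a i) (hb : ∀ i, 0 < b i)
include ha hb

theorem betaCoeff_last_pos : 0 < betaCoeff a b (Fin.last N) := by
  refine Finset.sum_pos' (fun j _ => div_nonneg (Finset.prod_nonneg fun u _ => ha u)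
    (Finset.prod_nonneg fun u _ => (hb u).le)) ⟨Fin.last N, by simp, ?_⟩
  simp [hb]

theorem extLoad_val_succ (i : Fin (N + 1)) :
    extLoad a b (i + 1) = alphaCoeff a b i + betaCoeff a b i * speed a b := by
  induction i using Fin.lastCases with
  | last =>
    rw [Fin.val_last, extLoad_last, speed,
      mul_div_cancel₀ _ (betaCoeff_last_pos ha hb).ne']
    ring
  | cast j => rw [Fin.val_castSucc, extLoad_succ, load]

/-- The traffic equations: in stationarity every particle has the mean velocity `speed a b`. -/
theorem extLoad_flow (i : Fin (N + 1)) :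
    b i * extLoad a b (i + 1) - a i * extLoad a b i = speed a b := by
  rw [extLoad_val_succ ha hb]
  have hbi := (hb i).ne'
  induction i using Fin.cases with
  | zero =>
    rw [alphaCoeff_zero, betaCoeff_zero, Fin.val_zero, extLoad_zero]
    field_simp
    ring
  | succ j =>
    have h := extLoad_val_succ ha hb j.castSucc
    rw [Fin.val_castSucc] at h
    rw [Fin.val_succ, h, alphaCoeff_succ, betaCoeff_succ]
    field_simp
    ring

/-- If the speed is positive the loads are computed from the left, otherwise from the right; in both
cases the traffic equations preserve positivity. -/
theorem extLoad_pos (k : ℕ) (hk : k ≤ N + 1) : 0 < extLoad a b k := by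
  have hflow := extLoad_flow ha hb
  rcases le_or_gt (speed a b) 0 with hv | hv
  · induction hk using Nat.decreasingInduction with
    | self => rw [extLoad_last]; exact one_pos
    | of_succ k hk ih =>
      have h := hflow ⟨k, hk⟩
      have h1 := mul_pos (hb ⟨k, hk⟩) ih
      exact pos_of_mul_pos_right (by simp only at h; linarith) (ha ⟨k, hk⟩)
  · induction k with
    | zero => rw [extLoad_zero]; exact one_pos
    | succ k ih =>
      have h := hflow ⟨k, hk⟩
      have h1 := mul_nonneg (ha ⟨k, hk⟩) (ih (by omega)).le
      exact pos_of_mul_pos_right (by simp only at h; linarith) (hb ⟨k, hk⟩).le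

/-- Weights for which the weighted mean position of the particles has a constant drift: the interior
terms in its drift cancel by the balance equations. -/
theorem exists_weights : ∃ c : Fin (N + 1) → ℝ, (∀ i, 0 ≤ c i) ∧ 0 < c (Fin.last N) ∧
    ∑ i, c i = 1 ∧ ∀ j : Fin N, c j.castSucc * b j.castSucc = c j.succ * a j.succ := by
  suffices h : ∃ c : Fin (N + 1) → ℝ, (∀ i, 0 ≤ c i) ∧ 0 < c (Fin.last N) ∧
      ∀ j : Fin N, c j.castSucc * b j.castSucc = c j.succ * a j.succ by
    obtain ⟨c, h0, hl, hc⟩ := h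
    have hs : 0 < ∑ i, c i := Finset.sum_pos' (fun i _ => h0 i) ⟨_, Finset.mem_univ _, hl⟩
    refine ⟨fun i => c i / ∑ i, c i, fun i => div_nonneg (h0 i) hs.le, div_pos hl hs, ?_, ?_⟩
    · rw [← Finset.sum_div, div_self hs.ne']
    · intro j
      rw [div_mul_eq_mul_div, hc, div_mul_eq_mul_div]
  induction N with
  | zero => exact ⟨fun _ => 1, fun _ => zero_le_one, one_pos, fun j => j.elim0⟩
  | succ N ih =>
    obtain ⟨c, h0, hl, hc⟩ := ih (a := fun i => a i.succ) (b := fun i => b i.succ)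
      (fun i => ha _) (fun i => hb _)
    refine ⟨Fin.cons (c 0 * a 1 / b 0) c, fun i => ?_, ?_, fun j => ?_⟩
    · induction i using Fin.cases with
      | zero => exact div_nonneg (mul_nonneg (h0 0) (ha 1)) (hb 0).le
      | succ i => exact h0 i
    · rw [← Fin.succ_last, Fin.cons_succ]
      exact hl
    · induction j using Fin.cases with
      | zero =>
        rw [Fin.castSucc_zero, Fin.cons_zero, Fin.cons_succ, div_mul_cancel₀ _ (hb 0).ne']
        rfl
      | succ j =>
        rw [Fin.castSucc_succ, Fin.cons_succ, Fin.cons_succ]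
        exact hc j

omit ha hb in
/-- Telescoping of the weighted drift, for arbitrary occupation variables `F k` of the interior
gaps. -/
theorem sum_weights_mul {c : Fin (N + 1) → ℝ}
    (hc : ∀ j : Fin N, c j.castSucc * b j.castSucc = c j.succ * a j.succ) (F : ℕ → ℝ)
    (h0 : F 0 = 1) (hN : F (N + 1) = 1) :
    ∑ i : Fin (N + 1), c i * (b i * F (i + 1) - a i * F i)
      = c (Fin.last N) * b (Fin.last N) - c 0 * a 0 := by
  have h1 : ∑ i : Fin (N + 1), c i * (b i * F (i + 1) - a i * F i)
      = ∑ i : Fin (N + 1), c i * b i * F (i + 1) - ∑ i : Fin (N + 1), c i * a i * F i := by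
    rw [← Finset.sum_sub_distrib]
    exact Finset.sum_congr rfl fun i _ => by ring
  rw [h1, Fin.sum_univ_castSucc, Fin.sum_univ_succ (fun i : Fin (N + 1) => c i * a i * F i)]
  simp only [Fin.val_castSucc, hc, Fin.val_last, hN, Fin.val_zero, h0, Fin.val_succ]
  ring

end Traffic

/-! ### The exclusion process -/

section Positions

variable {N : ℕ}

/-- The weighted mean position of the particles. -/
def weightedPos (c : Fin (N + 1) → ℝ) (x : Config N) : ℝ := ∑ i, c i * (x.1 i : ℝ)

theorem weightedPos_configJump_inl (c : Fin (N + 1) → ℝ) (i : Fin (N + 1)) (x : Config N) :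
    weightedPos c (configJump (Sum.inl i) x) - weightedPos c x
      = -(c i * if gapUnit i ≤ gapVec x then 1 else 0) := by
  simp only [weightedPos, configJump, Sum.elim_inl, stepLeft_apply, ← Finset.sum_sub_distrib]
  rw [Finset.sum_eq_single i]
  · split_ifs <;> first | contradiction | (push_cast; ring)
  · intro j _ hj
    simp [hj]
  · simp

theorem weightedPos_configJump_inr (c : Fin (N + 1) → ℝ) (i : Fin (N + 1)) (x : Config N) :
    weightedPos c (configJump (Sum.inr i) x) - weightedPos c x
      = c i * if gapUnit (i + 1) ≤ gapVec x then 1 else 0 := by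
  simp only [weightedPos, configJump, Sum.elim_inr, stepRight_apply, ← Finset.sum_sub_distrib]
  rw [Finset.sum_eq_single i]
  · split_ifs <;> first | contradiction | (push_cast; ring)
  · intro j _ hj
    simp [hj]
  · simp

/-- The long-time limit of the semigroup of the exclusion process, on products of a wave in the
centred weighted mean position with a function of the gaps. -/
theorem exists_limit_flow_generator {a b : Fin (N + 1) → ℝ} (ha : ∀ i, 0 ≤ a i)
    (hb : ∀ i, 0 < b i) (hload : ∀ i : Fin N, load a b i < 1) :
    ∃ (s : ℝ≥0) (c : Fin (N + 1) → ℝ) (π : Measure (Fin N → ℕ)) (_ : IsProbabilityMeasure π),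
      0 < s ∧ ∑ i, c i = 1 ∧ (∀ z, π.real {z} = ∏ i, load a b i ^ z i * (1 - load a b i)) ∧
      ∀ (x₀ : Config N) (g : (Fin N → ℕ) →ᵇ ℝ) (θ φ : ℝ),
        Tendsto (fun t : ℝ => flow (generator a b) t
          (wave (weightedPos c) (θ / √t) (φ - θ / √t * speed a b * t) * pullback gapVec g) x₀)
          atTop (𝓝 (mean π g * (Real.exp (-(θ ^ 2 / 2 * s)) * Real.cos φ))) := by
  obtain ⟨c, hc0, hcl, hc1, hcb⟩ := exists_weights ha hb
  have hpos : ∀ j, 0 < load a b j := fun j => by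
    rw [← extLoad_succ]
    exact extLoad_pos ha hb _ (by omega)
  obtain ⟨π, hπ, hsing⟩ := exists_geometric_product (load a b) hpos hload
  have hr : ∀ i, 0 ≤ Sum.elim a b i := by
    rintro (i | i)
    · exact ha i
    · exact (hb i).le
  have hstat : ∀ f, mean π (jumpGen (Sum.elim a b) gapJump f) = 0 :=
    mean_jumpGen_gapJump (ρ := extLoad a b) (extLoad_zero a b) (extLoad_last a b)
      (fun z => by simp_rw [extLoad_succ, hsing]) (extLoad_flow ha hb)
  have herg : ∀ (g : (Fin N → ℕ) →ᵇ ℝ) y,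
      Tendsto (fun t => flow (jumpGen (Sum.elim a b) gapJump) t g y) atTop (𝓝 (mean π g)) :=
    tendsto_flow_jumpGen_mean hr gapJump π hstat
      (fun z => by
        rw [hsing]
        exact (Finset.prod_pos fun j _ =>
          mul_pos (pow_pos (hpos j) _) (sub_pos.2 (hload j))).ne')
      (eqvGen_gapJump hb)
  -- `o k η` is the indicator that gap `k` contains an empty site.
  let o : ℕ → (Fin N → ℕ) → ℝ := fun k η => if gapUnit k ≤ η then 1 else 0
  have ho0 : ∀ η, o 0 η = 1 := fun η => by simp [o, gapUnit_zero]
  have hoN : ∀ η, o (N + 1) η = 1 := fun η => by simp [o, gapUnit_last]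
  have hoo : ∀ k η, o k η ^ 2 = o k η := fun k η => by simp [o]
  have ho : ∀ k η, 0 ≤ o k η ∧ o k η ≤ 1 := fun k η => by
    simp only [o]; split_ifs <;> simp
  have hcle : ∀ i, c i ≤ 1 := fun i => by
    rw [← hc1]
    exact Finset.single_le_sum (fun j _ => hc0 j) (Finset.mem_univ i)
  -- The rate of the squared jumps of the weighted mean position; its mean is the variance.
  let q₀ : (Fin N → ℕ) → ℝ := fun η =>
    ∑ i : Fin (N + 1), c i ^ 2 * (a i * o i η + b i * o (i + 1) η)
  have hterm : ∀ (i : Fin (N + 1)) η, 0 ≤ c i ^ 2 * (a i * o i η + b i * o (i + 1) η) :=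
    fun i η => mul_nonneg (sq_nonneg _) (add_nonneg (mul_nonneg (ha i) (ho _ _).1)
      (mul_nonneg (hb i).le (ho _ _).1))
  let q : (Fin N → ℕ) →ᵇ ℝ := BoundedContinuousFunction.ofNormedAddCommGroup q₀
    continuous_of_discreteTopology (∑ i : Fin (N + 1), c i ^ 2 * (a i * 1 + b i * 1)) fun η => by
      rw [Real.norm_of_nonneg (Finset.sum_nonneg fun i _ => hterm i η)]
      refine Finset.sum_le_sum fun i _ => ?_
      have := ha i
      have := (hb i).le
      have := (ho i η).2
      have := (ho (i + 1) η).2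
      gcongr
  -- The last particle is never blocked on its right, so that the variance is positive.
  have hq : ∀ η, c (Fin.last N) ^ 2 * b (Fin.last N) ≤ q η := fun η => by
    refine le_trans ?_ (Finset.single_le_sum
      (f := fun i : Fin (N + 1) => c i ^ 2 * (a i * o i η + b i * o (i + 1) η))
      (fun i _ => hterm i η) (Finset.mem_univ (Fin.last N)))
    simp only [Fin.val_last, hoN, mul_one]
    gcongr
    exact le_add_of_nonneg_left (mul_nonneg (ha _) (ho _ _).1)
  have hmq : 0 < mean π q := by
    refine (mul_pos (pow_pos hcl 2) (hb (Fin.last N))).trans_le ?_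
    have := integral_mono (integrable_const _) (q.integrable π) hq
    simpa [mean_apply] using this
  refine ⟨⟨mean π q, hmq.le⟩, c, π, hπ, hmq, hc1, hsing, fun x₀ g θ φ => ?_⟩
  rw [generator_eq_jumpGen]
  refine tendsto_flow_wave_mul hr configJump gapJump gapVec gapVec_configJump π herg
    (fun i x => ?_) (fun x => ?_) (fun x => ?_) x₀ g θ φ
  · rcases i with i | i
    · rw [weightedPos_configJump_inl, abs_neg, abs_of_nonneg (mul_nonneg (hc0 i) (ho _ _).1)]
      exact mul_le_one₀ (hcle i) (ho _ _).1 (ho _ _).2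
    · rw [weightedPos_configJump_inr, abs_of_nonneg (mul_nonneg (hc0 i) (ho _ _).1)]
      exact mul_le_one₀ (hcle i) (ho _ _).1 (ho _ _).2
  · -- The drift of the weighted mean position does not depend on the gaps; averaging it with
    -- the loads in place of the occupation variables identifies it.
    have h1 := sum_weights_mul hcb (fun k => o k (gapVec x)) (ho0 _) (hoN _)
    have h2 := sum_weights_mul hcb (extLoad a b) (extLoad_zero a b) (extLoad_last a b)
    simp_rw [extLoad_flow ha hb, ← Finset.sum_mul, hc1, one_mul] at h2
    rw [Fintype.sum_sum_type, ← Finset.sum_add_distrib, h2, ← h1]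
    refine Finset.sum_congr rfl fun i _ => ?_
    rw [weightedPos_configJump_inl, weightedPos_configJump_inr]
    simp only [Sum.elim_inl, Sum.elim_inr, o]
    ring
  · rw [Fintype.sum_sum_type, ← Finset.sum_add_distrib]
    refine Finset.sum_congr rfl fun i _ => ?_
    rw [weightedPos_configJump_inl, weightedPos_configJump_inr, neg_sq, mul_pow, mul_pow]
    change a i * (c i ^ 2 * o i (gapVec x) ^ 2) + b i * (c i ^ 2 * o (i + 1) (gapVec x) ^ 2) = _
    rw [hoo, hoo]
    ring

/-- The distance of particle `i` from the weighted mean position, as a function of the gaps. -/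
def offset (c : Fin (N + 1) → ℝ) (i : Fin (N + 1)) (η : Fin N → ℕ) : ℝ :=
  ∑ k, c k * (∑ j : Fin N, (if j.castSucc < i then (η j + 1 : ℝ) else 0)
    - ∑ j : Fin N, (if j.castSucc < k then (η j + 1 : ℝ) else 0))

theorem pos_eq_add_sum (x : Config N) (i : Fin (N + 1)) :
    (x.1 i : ℝ) = x.1 0 + ∑ j : Fin N, (if j.castSucc < i then (gapVec x j + 1 : ℝ) else 0) := by
  induction i using Fin.induction with
  | zero => simp
  | succ i ih =>
    have h : (gapVec x i + 1 : ℝ) = x.1 i.succ - x.1 i.castSucc := by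
      have h1 : ((gapVec x i : ℤ) : ℝ) = (gap x i : ℝ) := by rw [coe_gapVec]
      rw [gap] at h1
      push_cast at h1
      rw [h1]; ring
    have hsum : ∑ j : Fin N, (if j.castSucc < i.succ then (gapVec x j + 1 : ℝ) else 0)
        = ∑ j : Fin N, (if j.castSucc < i.castSucc then (gapVec x j + 1 : ℝ) else 0)
          + ∑ j : Fin N, (if j = i then (gapVec x j + 1 : ℝ) else 0) := by
      rw [← Finset.sum_add_distrib]
      refine Finset.sum_congr rfl fun j _ => ?_
      rcases lt_trichotomy j i with hj | rfl | hj
      · simp [hj.ne, hj, hj.le]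
      · simp
      · simp [hj.ne', hj.not_gt, hj.not_ge]
    rw [hsum, ← add_assoc, ← ih, Finset.sum_ite_eq', if_pos (Finset.mem_univ i), h]
    ring

theorem pos_eq_weightedPos_add_offset {c : Fin (N + 1) → ℝ} (hc : ∑ i, c i = 1) (x : Config N)
    (i : Fin (N + 1)) : (x.1 i : ℝ) = weightedPos c x + offset c i (gapVec x) := by
  have h : offset c i (gapVec x) = ∑ k, c k * ((x.1 i : ℝ) - x.1 k) := by
    refine Finset.sum_congr rfl fun k _ => ?_
    rw [pos_eq_add_sum x i, pos_eq_add_sum x k]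
    ring
  rw [h, weightedPos, ← Finset.sum_add_distrib]
  simp_rw [← mul_add, add_sub_cancel]
  rw [← Finset.sum_mul, hc, one_mul]

end Positions

/-! ### Limit laws of the process -/

section Law

variable {N : ℕ} {a b : Fin (N + 1) → ℝ} {x₀ : Config N} {Ω : Type*} [MeasurableSpace Ω]
  {P : Measure Ω} [IsProbabilityMeasure P] {X : ℝ≥0 → Ω → Config N}

theorem integral_comp_process (hX : IsExclusionProcess a b x₀ P X) (t : ℝ≥0)
    (f : Config N →ᵇ ℝ) : ∫ ω, f (X t ω) ∂P = flow (generator a b) t f x₀ := by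
  have hle : ⨆ r : Set.Iic (0 : ℝ≥0), MeasurableSpace.comap (X r) inferInstance
      ≤ (inferInstance : MeasurableSpace Ω) := iSup_le fun r => (hX.measurable r).comap_le
  have h := hX.markov 0 t f
  rw [zero_add] at h
  rw [← integral_condExp hle, integral_congr_ae h]
  have h0 : (fun ω => semigroup a b t f (X 0 ω)) =ᵐ[P] fun _ => flow (generator a b) t f x₀ := by
    filter_upwards [hX.initial] with ω hω
    rw [hω]
    rfl
  rw [integral_congr_ae h0]
  simp

/-- The characteristic function of the centred weighted mean position, jointly with a function `g`
of the gaps. -/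
theorem tendsto_integral_cexp (hX : IsExclusionProcess a b x₀ P X) {s v : ℝ}
    {c : Fin (N + 1) → ℝ} {π : Measure (Fin N → ℕ)} [IsProbabilityMeasure π]
    {g : (Fin N → ℕ) →ᵇ ℝ} {θ : ℝ}
    (hlim : ∀ φ : ℝ, Tendsto (fun t : ℝ => flow (generator a b) t
      (wave (weightedPos c) (θ / √t) (φ - θ / √t * v * t) * pullback gapVec g) x₀)
      atTop (𝓝 (mean π g * (Real.exp (-(θ ^ 2 / 2 * s)) * Real.cos φ)))) :
    Tendsto (fun t : ℝ≥0 => ∫ ω, (g (gapVec (X t ω)) : ℂ) *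
      Complex.exp ((θ * ((weightedPos c (X t ω) - v * t) / √(t : ℝ)) : ℝ) * Complex.I) ∂P)
      atTop (𝓝 (mean π g * Real.exp (-(θ ^ 2 / 2 * s)))) := by
  -- The phases `0` and `-π / 2` give the real and the imaginary part.
  have h : ∀ t : ℝ≥0, ∫ ω, (g (gapVec (X t ω)) : ℂ) *
      Complex.exp ((θ * ((weightedPos c (X t ω) - v * t) / √(t : ℝ)) : ℝ) * Complex.I) ∂P
      = (flow (generator a b) t
          (wave (weightedPos c) (θ / √t) (0 - θ / √t * v * t) * pullback gapVec g) x₀ : ℂ)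
        + (flow (generator a b) t
          (wave (weightedPos c) (θ / √t) (-(Real.pi / 2) - θ / √t * v * t)
            * pullback gapVec g) x₀ : ℂ) * Complex.I := fun t => by
    have hint : ∀ f : Config N →ᵇ ℝ, Integrable (fun ω => ((f (X t ω) : ℝ) : ℂ)) P := fun f =>
      (Integrable.of_bound ((Measurable.of_discrete.comp (hX.measurable t)).aestronglyMeasurable)
        ‖f‖ (Eventually.of_forall fun ω => f.norm_coe_le_norm _)).ofReal
    rw [← integral_comp_process hX, ← integral_comp_process hX, ← integral_complex_ofReal,
      ← integral_complex_ofReal, ← integral_mul_const,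
      ← integral_add (hint _) ((hint _).mul_const _)]
    refine integral_congr_ae (Eventually.of_forall fun ω => ?_)
    have e1 : θ / √(t : ℝ) * weightedPos c (X t ω) + (0 - θ / √(t : ℝ) * v * t)
        = θ * ((weightedPos c (X t ω) - v * t) / √(t : ℝ)) := by ring
    have e2 : θ / √(t : ℝ) * weightedPos c (X t ω) + (-(Real.pi / 2) - θ / √(t : ℝ) * v * t)
        = θ * ((weightedPos c (X t ω) - v * t) / √(t : ℝ)) - Real.pi / 2 := by ring
    simp only [BoundedContinuousFunction.coe_mul, Pi.mul_apply, wave_apply, pullback_apply, e1, e2,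
      Real.cos_sub_pi_div_two]
    rw [Complex.exp_mul_I, ← Complex.ofReal_cos, ← Complex.ofReal_sin]
    push_cast
    ring
  simp_rw [h]
  have h0 := ((Complex.continuous_ofReal.tendsto _).comp (hlim 0)).comp
    (NNReal.tendsto_coe_atTop.2 tendsto_id)
  have h1 := ((Complex.continuous_ofReal.tendsto _).comp (hlim (-(Real.pi / 2)))).comp
    (NNReal.tendsto_coe_atTop.2 tendsto_id)
  simpa using h0.add (h1.mul_const Complex.I)

end Law

/-- The indicator function of a set of a discrete space, as a bounded function. -/
noncomputable def indicatorBCF {G : Type*} [TopologicalSpace G] [DiscreteTopology G] (A : Set G) :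
    G →ᵇ ℝ :=
  BoundedContinuousFunction.ofNormedAddCommGroup (A.indicator 1) continuous_of_discreteTopology 1
    fun x => by
      by_cases h : x ∈ A <;> simp [h]

theorem mean_indicatorBCF {G : Type*} [TopologicalSpace G] [DiscreteTopology G] [MeasurableSpace G]
    [DiscreteMeasurableSpace G] (π : Measure G) [IsProbabilityMeasure π] (A : Set G) :
    mean π (indicatorBCF A) = π.real A :=
  integral_indicator_one (MeasurableSet.of_discrete (s := A))

/-- Lévy's continuity theorem along a general filter. -/
theorem tendsto_probabilityMeasure_of_charFun {T : Type*} {l : Filter T} [l.IsCountablyGenerated]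
    {μ : T → ProbabilityMeasure ℝ} {ν : ProbabilityMeasure ℝ}
    (h : ∀ θ : ℝ, Tendsto (fun t => charFun (μ t) θ) l (𝓝 (charFun ν θ))) :
    Tendsto μ l (𝓝 ν) :=
  tendsto_of_seq_tendsto fun _ hu =>
    ProbabilityMeasure.tendsto_of_tendsto_charFun fun θ => (h θ).comp hu

section Limits

variable {N : ℕ} {Ω : Type*} [MeasurableSpace Ω]
  {P : Measure Ω} [IsProbabilityMeasure P] {X : ℝ≥0 → Ω → Config N} (hX : ∀ t, Measurable (X t))
  {s : ℝ≥0} (hs : 0 < s) {v : ℝ} {c : Fin (N + 1) → ℝ} (hc : ∑ i, c i = 1)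
  {π : Measure (Fin N → ℕ)} [IsProbabilityMeasure π]
  (hlim : ∀ (g : (Fin N → ℕ) →ᵇ ℝ) (θ : ℝ),
    Tendsto (fun t : ℝ≥0 => ∫ ω, (g (gapVec (X t ω)) : ℂ) *
      Complex.exp ((θ * ((weightedPos c (X t ω) - v * t) / √(t : ℝ)) : ℝ) * Complex.I) ∂P)
      atTop (𝓝 (mean π g * Real.exp (-(θ ^ 2 / 2 * s)))))
include hX hlim

omit [IsProbabilityMeasure P] in
theorem tendsto_real_gapVec_mem (A : Set (Fin N → ℕ)) :
    Tendsto (fun t => P.real {ω | gapVec (X t ω) ∈ A}) atTop (𝓝 (π.real A)) := by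
  have h := (Complex.continuous_re.tendsto _).comp (hlim (indicatorBCF A) 0)
  simp only [mean_indicatorBCF] at h
  refine (h.congr fun t => ?_).trans (by simp)
  have hm : MeasurableSet {ω | gapVec (X t ω) ∈ A} :=
    (Measurable.of_discrete (f := gapVec)).comp (hX t) (MeasurableSet.of_discrete (s := A))
  rw [← integral_indicator_one hm]
  simp only [Function.comp_apply, zero_mul, Complex.ofReal_zero, Complex.exp_zero, mul_one]
  rw [integral_complex_ofReal, Complex.ofReal_re]
  rfl

include hc hs in
/-- Convergence of the joint distribution of the leftmost particle and the gaps: on the event that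
the gaps equal `z`, the leftmost particle is at a fixed distance from the weighted mean position, so
that Lévy's theorem applies to its conditional law. -/
theorem tendsto_joint (w : ℝ) (z : Fin N → ℕ) (hz : π.real {z} ≠ 0) :
    Tendsto (fun t : ℝ≥0 => P.real {ω |
      (((X t ω).1 0 : ℝ) - v * t) / √((s : ℝ) * t) ≤ w ∧ gapVec (X t ω) = z}) atTop
      (𝓝 (cdf (gaussianReal 0 1) w * π.real {z})) := by
  let A : ℝ≥0 → Set Ω := fun t => {ω | gapVec (X t ω) = z}
  let W : ℝ≥0 → Ω → ℝ := fun t ω => (((X t ω).1 0 : ℝ) - v * t) / √((s : ℝ) * t)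
  have hA : ∀ t, MeasurableSet (A t) := fun t =>
    (Measurable.of_discrete (f := gapVec)).comp (hX t) (MeasurableSet.singleton z)
  have hW : ∀ t, Measurable (W t) := fun t =>
    (Measurable.of_discrete (f := fun x : Config N =>
      ((x.1 0 : ℝ) - v * t) / √((s : ℝ) * t))).comp (hX t)
  have hPA : Tendsto (fun t => P.real (A t)) atTop (𝓝 (π.real {z})) :=
    tendsto_real_gapVec_mem hX hlim {z}
  have hev : ∀ᶠ t in atTop, P.real (A t) ≠ 0 := hPA.eventually_ne hz
  have hprob : ∀ t, IsProbabilityMeasure (if P.real (A t) ≠ 0 then (P[|A t]).map (W t)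
      else gaussianReal 0 1) := fun t => by
    split_ifs with h
    · have : IsProbabilityMeasure (P[|A t]) := cond_isProbabilityMeasure fun h0 => h (by
        simp [measureReal_def, h0])
      exact Measure.isProbabilityMeasure_map (hW t).aemeasurable
    · infer_instance
  -- The conditional law of `W t`; the value chosen where it is undefined does not matter, as the
  -- event `A t` has positive probability for large `t`.
  let μ : ℝ≥0 → ProbabilityMeasure ℝ := fun t => ⟨_, hprob t⟩
  let ν : ProbabilityMeasure ℝ := ⟨gaussianReal 0 1, inferInstance⟩
  have hμ : Tendsto μ atTop (𝓝 ν) := by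
    refine tendsto_probabilityMeasure_of_charFun fun θ => ?_
    have hchar : charFun (ν : Measure ℝ) θ = (Real.exp (-(θ ^ 2 / 2)) : ℝ) := by
      change charFun (gaussianReal 0 1) θ = _
      rw [charFun_gaussianReal]
      push_cast
      congr 1
      simp
    have hphase : Tendsto (fun t : ℝ≥0 => Complex.exp
        ((θ / √(s : ℝ) * (offset c 0 z / √(t : ℝ)) : ℝ) * Complex.I)) atTop (𝓝 1) := by
      have h1 : Tendsto (fun t : ℝ≥0 => offset c 0 z / √(t : ℝ)) atTop (𝓝 0) :=
        Tendsto.const_div_atTop (Real.tendsto_sqrt_atTop.comp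
          (NNReal.tendsto_coe_atTop.2 tendsto_id)) _
      have h2 := ((Complex.continuous_ofReal.tendsto _).comp
        (h1.const_mul (θ / √(s : ℝ)))).mul_const Complex.I
      simpa [Function.comp_def] using (Complex.continuous_exp.tendsto _).comp h2
    have hmain := ((hlim (indicatorBCF {z}) (θ / √(s : ℝ))).mul hphase).div
      ((Complex.continuous_ofReal.tendsto _).comp hPA) (by simpa using hz)
    rw [mean_indicatorBCF, mul_one, mul_div_cancel_left₀ _ (by simpa using hz), div_pow,
      Real.sq_sqrt s.coe_nonneg] at hmain
    rw [hchar]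
    have hexp : -(θ ^ 2 / s / 2 * s) = -(θ ^ 2 / 2) := by
      have : (s : ℝ) ≠ 0 := by exact_mod_cast hs.ne'
      field_simp
    rw [hexp] at hmain
    refine hmain.congr' ?_
    filter_upwards [hev] with t ht
    have hμt : (μ t : Measure ℝ) = (P[|A t]).map (W t) := if_pos ht
    rw [hμt, charFun_apply_real, integral_map (hW t).aemeasurable (by fun_prop),
      ProbabilityTheory.cond, integral_smul_measure, ← integral_indicator (hA t)]
    simp only [Pi.div_apply, Function.comp_apply]
    rw [← integral_mul_const, ENNReal.toReal_inv, ← measureReal_def, Complex.real_smul,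
      Complex.ofReal_inv, ← div_eq_inv_mul]
    congr 1
    refine integral_congr_ae (Eventually.of_forall fun ω => ?_)
    dsimp only
    by_cases hω : gapVec (X t ω) = z
    · rw [Set.indicator_of_mem (show ω ∈ A t from hω)]
      have h1 : indicatorBCF {z} (gapVec (X t ω)) = 1 := by simp [indicatorBCF, hω]
      rw [h1, Complex.ofReal_one, one_mul, ← Complex.exp_add, ← add_mul, ← Complex.ofReal_add,
        ← Complex.ofReal_mul]
      congr 3
      simp only [W]
      rw [pos_eq_weightedPos_add_offset hc, hω, Real.sqrt_mul s.coe_nonneg]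
      ring
    · rw [Set.indicator_of_notMem (show ω ∉ A t from hω)]
      have h1 : indicatorBCF {z} (gapVec (X t ω)) = 0 := by simp [indicatorBCF, hω]
      rw [h1]
      simp
  have hIic := ProbabilityMeasure.tendsto_measure_of_null_frontier_of_tendsto' hμ
    (E := Set.Iic w) (by
      rw [frontier_Iic]
      have := nullSingletonClass_gaussianReal (μ := 0) one_ne_zero
      exact measure_singleton (μ := gaussianReal 0 1) w)
  have hreal := (ENNReal.tendsto_toReal (measure_ne_top (gaussianReal 0 1) (Set.Iic w))).comp hIic
  rw [cdf_eq_real]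
  refine (hreal.mul hPA).congr' ?_
  filter_upwards [hev] with t ht
  have hμt : (μ t : Measure ℝ) = (P[|A t]).map (W t) := if_pos ht
  rw [Function.comp_apply, hμt, Measure.map_apply (hW t) measurableSet_Iic,
    cond_apply (hA t), ENNReal.toReal_mul, ENNReal.toReal_inv, ← measureReal_def,
    ← measureReal_def, mul_comm, mul_inv_cancel_left₀ ht]
  congr 1
  ext ω
  simp [A, W, and_comm]

theorem tendstoInDistribution_weightedPos {Ω' : Type*} [MeasurableSpace Ω'] {P' : Measure Ω'}
    [IsProbabilityMeasure P'] {Z : Ω' → ℝ} (hZ : HasLaw Z (gaussianReal 0 s) P') :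
    TendstoInDistribution (fun (t : ℝ≥0) ω => (weightedPos c (X t ω) - v * t) / √(t : ℝ)) atTop Z
      (fun _ => P) P' := by
  have hV : ∀ t : ℝ≥0, Measurable fun ω => (weightedPos c (X t ω) - v * t) / √(t : ℝ) := fun t =>
    (Measurable.of_discrete (f := fun x : Config N =>
      (weightedPos c x - v * t) / √(t : ℝ))).comp (hX t)
  refine ⟨fun t => (hV t).aemeasurable, hZ.aemeasurable, ?_⟩
  refine tendsto_probabilityMeasure_of_charFun fun θ => ?_
  have h := hlim (BoundedContinuousFunction.const _ 1) θ
  have h1 : mean π (BoundedContinuousFunction.const (Fin N → ℕ) 1) = 1 := by simp [mean_apply]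
  have hchar : charFun (P'.map Z) θ = (Real.exp (-(θ ^ 2 / 2 * s)) : ℝ) := by
    rw [hZ.map_eq, charFun_gaussianReal]
    push_cast
    congr 1
    simp
    ring
  simp only [ProbabilityMeasure.coe_mk]
  rw [hchar]
  rw [h1, Complex.ofReal_one, one_mul] at h
  refine h.congr fun t => ?_
  rw [charFun_apply_real, integral_map (hV t).aemeasurable (by fun_prop)]
  simp

/-- The distances between the particles are of order one. -/
theorem tendsto_real_mul_sqrt_le (D : (Fin N → ℕ) → ℝ) {ε : ℝ} (hε : 0 < ε) :
    Tendsto (fun t : ℝ≥0 => P.real {ω | ε * √(t : ℝ) ≤ D (gapVec (X t ω))}) atTop (𝓝 0) := by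
  have htail : Tendsto (fun n : ℕ => π.real {η | (n : ℝ) ≤ D η}) atTop (𝓝 0) := by
    have h : ⋂ n : ℕ, {η | (n : ℝ) ≤ D η} = ∅ := by
      ext η
      obtain ⟨n, hn⟩ := exists_nat_gt (D η)
      simpa using ⟨n, hn⟩
    have h1 := tendsto_measure_iInter_atTop (μ := π) (s := fun n : ℕ => {η | (n : ℝ) ≤ D η})
      (fun n => MeasurableSet.of_discrete.nullMeasurableSet)
      (fun m n hmn η (hη : (n : ℝ) ≤ D η) => le_trans (by exact_mod_cast hmn) hη)
      ⟨0, measure_ne_top _ _⟩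
    rw [h, measure_empty] at h1
    simpa [Function.comp_def, measureReal_def] using
      (ENNReal.tendsto_toReal ENNReal.zero_ne_top).comp h1
  rw [Metric.tendsto_atTop']
  intro δ hδ
  obtain ⟨n, hn⟩ := (htail.eventually_lt_const hδ).exists
  have hsqrt : Tendsto (fun t : ℝ≥0 => ε * √(t : ℝ)) atTop atTop :=
    (Real.tendsto_sqrt_atTop.comp (NNReal.tendsto_coe_atTop.2 tendsto_id)).const_mul_atTop hε
  obtain ⟨t₀, ht₀⟩ := eventually_atTop.1
    (((tendsto_real_gapVec_mem hX hlim {η | (n : ℝ) ≤ D η}).eventually_lt_const hn).and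
      (hsqrt.eventually_ge_atTop (n : ℝ)))
  refine ⟨t₀, fun t ht => ?_⟩
  rw [Real.dist_eq, sub_zero, abs_of_nonneg measureReal_nonneg]
  refine lt_of_le_of_lt (measureReal_mono fun ω hω => ?_) (ht₀ t ht.le).1
  exact (ht₀ t ht.le).2.trans hω

include hc in
/-- All particles have the same fluctuations as the weighted mean position, by Slutsky's theorem. -/
theorem tendstoInDistribution_pos {Ω' : Type*} [MeasurableSpace Ω'] {P' : Measure Ω'}
    [IsProbabilityMeasure P'] {Z : Ω' → ℝ} (hZ : HasLaw Z (gaussianReal 0 s) P') :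
    TendstoInDistribution
      (fun (t : ℝ≥0) (ω : Ω) (i : Fin (N + 1)) => (((X t ω).1 i : ℝ) - v * t) / √(t : ℝ))
      atTop (fun (ω' : Ω') (_ : Fin (N + 1)) => Z ω') (fun _ => P) P' := by
  have h1 := (tendstoInDistribution_weightedPos hX hlim hZ).continuous_comp
    (g := fun (y : ℝ) (_ : Fin (N + 1)) => y) (by fun_prop)
  refine tendstoInDistribution_of_tendstoInMeasure_sub _ _ h1 ?_ fun t => ?_
  · rw [tendstoInMeasure_iff_measureReal_norm]
    intro ε hε
    refine squeeze_zero' (Eventually.of_forall fun t => measureReal_nonneg) ?_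
      (tendsto_real_mul_sqrt_le hX hlim (fun η => ∑ i, |offset c i η|) hε)
    filter_upwards [eventually_gt_atTop 0] with t ht
    refine measureReal_mono fun ω hω => ?_
    have ht' : 0 < √(t : ℝ) := Real.sqrt_pos.2 (by exact_mod_cast ht)
    rw [Set.mem_ofPred_eq, ← le_div_iff₀ ht']
    refine le_trans hω ((pi_norm_le_iff_of_nonneg (by positivity)).2 fun i => ?_)
    simp only [Pi.sub_apply, Pi.zero_apply, sub_zero, Function.comp_apply]
    rw [pos_eq_weightedPos_add_offset hc (X t ω) i, ← sub_div, add_sub_right_comm,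
      add_sub_cancel_left, norm_div, Real.norm_of_nonneg ht'.le, Real.norm_eq_abs]
    gcongr
    exact Finset.single_le_sum (f := fun i => |offset c i (gapVec (X t ω))|)
      (fun _ _ => abs_nonneg _) (Finset.mem_univ i)
  · exact ((Measurable.of_discrete (f := fun (x : Config N) (i : Fin (N + 1)) =>
      ((x.1 i : ℝ) - v * t) / √(t : ℝ))).comp (hX t)).aemeasurable

end Limits

end Exclusion

theorem mainTheorem3 (N : ℕ) (hN : 1 ≤ N) (a b : Fin (N + 1) → ℝ)
    (ha : ∀ i, 0 ≤ a i) (hb : ∀ i, 0 < b i)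
    (hload : ∀ i : Fin N, Exclusion.load a b i < 1) :
    ∃ σsq : ℝ≥0, 0 < σsq ∧
      ∀ (Ω : Type*) [MeasurableSpace Ω] (P : Measure Ω) [IsProbabilityMeasure P]
        (x₀ : Exclusion.Config N) (X : ℝ≥0 → Ω → Exclusion.Config N),
        Exclusion.IsExclusionProcess a b x₀ P X →
        (∀ (w : ℝ) (z : Fin N → ℕ),
          Tendsto
            (fun t : ℝ≥0 => P.real {ω |
              (((X t ω).1 0 : ℝ) - Exclusion.speed a b * t) / √((σsq : ℝ) * t) ≤ w ∧
                ∀ i : Fin N, Exclusion.gap (X t ω) i = (z i : ℤ)})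
            atTop
            (𝓝 (cdf (gaussianReal 0 1) w *
              ∏ i : Fin N, Exclusion.load a b i ^ z i * (1 - Exclusion.load a b i)))) ∧
        (∀ (Ω' : Type*) [MeasurableSpace Ω'] (P' : Measure Ω') [IsProbabilityMeasure P']
          (Z : Ω' → ℝ), HasLaw Z (gaussianReal 0 σsq) P' →
          TendstoInDistribution
            (fun (t : ℝ≥0) (ω : Ω) (i : Fin (N + 1)) =>
              (((X t ω).1 i : ℝ) - Exclusion.speed a b * t) / √(t : ℝ))
            atTop (fun (ω' : Ω') (_ : Fin (N + 1)) => Z ω') (fun _ => P) P') := by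
  obtain ⟨s, c, π, _, hs, hc, hπ, hflow⟩ := Exclusion.exists_limit_flow_generator ha hb hload
  refine ⟨s, hs, fun Ω _ P _ x₀ X hX => ?_⟩
  have hlim := fun g θ => Exclusion.tendsto_integral_cexp hX (g := g) (hflow x₀ g θ)
  refine ⟨fun w z => ?_, fun Ω' _ P' _ Z hZ =>
    Exclusion.tendstoInDistribution_pos hX.measurable hc hlim hZ⟩
  have hz : π.real {z} ≠ 0 := by
    rw [hπ]
    refine (Finset.prod_pos fun i _ => mul_pos (pow_pos ?_ _) (sub_pos.2 (hload i))).ne'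
    rw [← Exclusion.extLoad_succ]
    exact Exclusion.extLoad_pos ha hb _ (by omega)
  have h := Exclusion.tendsto_joint hX.measurable hs hc hlim w z hz
  rw [hπ] at h
  refine h.congr fun t => ?_
  simp only [funext_iff, ← Exclusion.coe_gapVec, Nat.cast_inj]
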